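/- Let $a,b,c,d\in\mathbb R\cup\{\infty\}$, write $(a_1,a_2,a_3)=(a,b,c)$, and take all indices in $\{1,2,3\}$ modulo 3. Let $Sk=Sk(a,b,c,d)\subset\mathbb R^3$ be the set of points $x=(x_1,x_2,x_3)$ at which the minimum $$f(x)=\min(2x_1,\,2x_2,\,2x_3,\,x_1+x_2+x_3,\,a+x_1,\,b+x_2,\,c+x_3,\,d)$$ is attained by at least two of the eight terms and $x_1+x_2+x_3=f(x)$. The quadratic cell $\mathcal C(X_i^2)$ is the set of $x\in Sk$ with $x_1+x_2+x_3=2x_i$; its interior is taken in the plane $x_1+x_2+x_3=2x_i$. Let $s_i$ be the involution of $\mathbb R^3$ that replaces $x_i$ by $$\min(2x_{i+1},\,2x_{i-1},\,a_{i+1}+x_{i+1},\,a_{i-1}+x_{i-1},\,d)-x_i$$ and fixes the other two coordinates, and let $\Gamma=\langle s_1,s_2,s_3\rangle$, which preserves $Sk$. Let $D_i$ be the side of the fixed set of $s_i$ in $Sk$ that contains the interior of $\mathcal C(X_i^2)$ (a union of connected components of $Sk\setminus\mathrm{Fix}(s_i)$). With closures $\overline{D}_i$ and boundaries $\partial D_i$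 taken in $Sk$, put $L_i=\partial D_i\setminus\bigcup_{j\ne i}\overline{D}_j$, $$D_0=\Bigl(Sk\setminus\bigcup_{i=1}^3\overline{D}_i\Bigr)\cup\bigcup_{i=1}^3L_i,\qquad U=\Gamma.D_0 .$$ For real $s,t$ let $\gcd(s,t)=|s|\cdot\tau(t/s)$ if $s\neq0$ and $\gcd(0,t)=|t|$, where $\tau(p/q)=1/|q|$ for coprime integers $p,q$ with $q\ne0$, and $\tau=0$ at irrational numbers. Put $u^i_1(x)=x_{i+1}-x_i$ and $u^i_2(x)=x_{i-1}-x_i$; for $x\in\mathcal C(X_i^2)$ these are nonnegative, and the slope of $x$ is $m=u^i_2(x)/u^i_1(x)\in[0,\infty]$. Define $T:[0,\infty]\to[0,\infty]$ by $T(m)=\frac1m-1$ for $m<1$ and $T(m)=\frac1{m-1}$ for $m\ge1$ (with $\frac10=\infty$, $\frac1\infty=0$). For a slope $m$ put $st=\inf\{j>0: T^j(m)\in\{0,\infty\}\}$ and define the index shift $$\delta=\delta(m)=\#\{j\in[0,st):T^j(m)\ge1\}-\#\{j\in[0,st):T^j(m)<1\},$$ where $\delta=0$ by convention if no such $j>0$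 exists (which happens exactly for irrational $m$). Finally define the thresholds $$\Theta_1=\min(0,\tfrac12a,b,c,\tfrac12d),\quad \Theta_2=\min(0,a,\tfrac12b,c,\tfrac12d),\quad \Theta_3=\min(0,a,b,\tfrac12c,\tfrac12d).$$ **Theorem.** Suppose $\min(a,b,c,d)<0$ and $x$ lies in the interior of $\mathcal C(X_i^2)$, with slope $m=u^i_2(x)/u^i_1(x)$ and index shift $\delta=\delta(m)$. Then $\gcd(u^i_1(x),u^i_2(x))=\gcd(x_1-x_3,x_2-x_3)$, and $$x\notin U\quad\Longleftrightarrow\quad \gcd(x_1-x_3,x_2-x_3)\ \ge\ -\Theta_{i+\delta-1},$$ where the index $i+\delta-1$ is taken modulo 3. -/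

import Mathlib

open Set Topology
open scoped ENNReal

namespace TropMarkov

noncomputable section

/-- Points of `ℝ³`. The coordinates are indexed by `ZMod 3`, so `x 1`, `x 2`, `x 3` are the three
coordinates and index arithmetic is modulo 3. -/
abbrev Pt : Type := ZMod 3 → ℝ

/-- The valuations `a, b, c, d ∈ ℝ ∪ {∞}` of the parameters `A, B, C, D`. -/
structure Params where
  a : WithTop ℝ
  b : WithTop ℝ
  c : WithTop ℝ
  d : WithTop ℝ

/-- The valuation of the coefficient of the linear term in `X i`: it is `a`, `b`, `c` for
`i = 1, 2, 3`. -/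
def Params.coef (P : Params) (i : ZMod 3) : WithTop ℝ :=
  if i = 1 then P.a else if i = 2 then P.b else P.c

/-! ### The tropical polynomial, the skeleton and the cells -/

/-- The eight monomials of `X₁² + X₂² + X₃² + X₁X₂X₃ - AX₁ - BX₂ - CX₃ - D`. -/
inductive Mon : Type
  | sq (i : ZMod 3)
  | lin (i : ZMod 3)
  | const
  | prod

/-- The value at `x` of the tropical monomial attached to a monomial. -/
def tropMon (P : Params) (x : Pt) : Mon → WithTop ℝ
  | Mon.sq i => ((2 * x i : ℝ) : WithTop ℝ)
  | Mon.lin i => P.coef i + (x i : WithTop ℝ)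
  | Mon.const => P.d
  | Mon.prod => ((x 1 + x 2 + x 3 : ℝ) : WithTop ℝ)

/-- The tropical polynomial
`f(x) = min(2x₁, 2x₂, 2x₃, x₁+x₂+x₃, a+x₁, b+x₂, c+x₃, d)`. -/
def tropPoly (P : Params) (x : Pt) : WithTop ℝ :=
  min (tropMon P x (Mon.sq 1)) <| min (tropMon P x (Mon.sq 2)) <| min (tropMon P x (Mon.sq 3)) <|
    min (tropMon P x Mon.prod) <| min (tropMon P x (Mon.lin 1)) <| min (tropMon P x (Mon.lin 2)) <|
    min (tropMon P x (Mon.lin 3)) (tropMon P x Mon.const)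

/-- The tropical surface: the minimum defining `f` is attained by at least two monomials. -/
def tropSurface (P : Params) : Set Pt :=
  {x | ∃ m m' : Mon, m ≠ m' ∧ tropMon P x m = tropPoly P x ∧ tropMon P x m' = tropPoly P x}

/-- The skeleton `Sk(a,b,c,d)`: points of the tropical surface with `x₁+x₂+x₃ = f(x)`. -/
def skeleton (P : Params) : Set Pt :=
  {x | x ∈ tropSurface P ∧ tropMon P x Mon.prod = tropPoly P x}

/-- The cell `C(m)` of the skeleton. -/
def cell (P : Params) (m : Mon) : Set Pt :=
  {x | x ∈ skeleton P ∧ tropMon P x Mon.prod = tropMon P x m}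

/-- The plane `x₁ + x₂ + x₃ = 2xᵢ` on which the quadratic cell `C(Xᵢ²)` sits. -/
def quadPlane (i : ZMod 3) : Set Pt :=
  {x | x 1 + x 2 + x 3 = 2 * x i}

/-- The (planar) interior of the quadratic cell `C(Xᵢ²)`: its interior as a subset of the plane
on which it sits. -/
def quadCellInterior (P : Params) (i : ZMod 3) : Set Pt :=
  {x | x ∈ cell P (Mon.sq i) ∧ cell P (Mon.sq i) ∈ 𝓝[quadPlane i] x}

/-! ### The tropicalized Vieta involutions and the group they generate -/

/-- For `i = 1` this is `min(2x₂, 2x₃, b+x₂, c+x₃, d)`, and cyclically. -/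
def vietaMin (P : Params) (i : ZMod 3) (x : Pt) : WithTop ℝ :=
  min (tropMon P x (Mon.sq (i + 1))) <| min (tropMon P x (Mon.sq (i - 1))) <|
    min (tropMon P x (Mon.lin (i + 1))) <| min (tropMon P x (Mon.lin (i - 1)))
    (tropMon P x Mon.const)

theorem vietaMin_ne_top (P : Params) (i : ZMod 3) (x : Pt) : vietaMin P i x ≠ ⊤ :=
  ne_top_of_le_ne_top (WithTop.coe_ne_top (a := 2 * x (i + 1))) (min_le_left _ _)

/-- The tropicalized Vieta involution `trop(sᵢ)` on `ℝ³`: it replaces the coordinate `xᵢ` by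
`vietaMin P i x - xᵢ`. -/
def tropVieta (P : Params) (i : ZMod 3) (x : Pt) : Pt :=
  Function.update x i ((vietaMin P i x).untop (vietaMin_ne_top P i x) - x i)

theorem vietaMin_update (P : Params) (i : ZMod 3) (x : Pt) (t : ℝ) :
    vietaMin P i (Function.update x i t) = vietaMin P i x := by
  have h1 : i + 1 ≠ i := by revert i; decide
  have h2 : i - 1 ≠ i := by revert i; decide
  simp [vietaMin, tropMon, h1, h2]

theorem tropVieta_involutive (P : Params) (i : ZMod 3) :
    Function.Involutive (tropVieta P i) := by
  intro x
  simp [tropVieta, vietaMin_update]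

/-- The group `Γ = ⟨s₁, s₂, s₃⟩`, as a group of transformations of `ℝ³`. -/
def vietaGroup (P : Params) : Subgroup (Equiv.Perm Pt) :=
  Subgroup.closure (Set.range fun i : ZMod 3 => (tropVieta_involutive P i).toPerm)

/-! ### The domains, the ping-pong table and the set `U` -/

/-- The open half-space `Dᵢ` of the skeleton: the side of the fixed curve of `trop(sᵢ)` on the
skeleton that contains the interior of `C(Xᵢ²)`, that is, the part of the complement of the fixed
set that is joined within this complement to the interior of `C(Xᵢ²)`. -/
def domain (P : Params) (i : ZMod 3) : Set Pt :=
  {x | ∃ y ∈ quadCellInterior P i,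
    x ∈ connectedComponentIn (skeleton P \ Function.fixedPoints (tropVieta P i)) y}

/-- The boundary of a subset `S` of the skeleton within the (closed) skeleton. -/
def skFrontier (P : Params) (S : Set Pt) : Set Pt :=
  skeleton P ∩ (closure S ∩ closure (skeleton P \ S))

/-- The ping-pong net `Lᵢ = ∂Dᵢ ∖ ⋃_{j ≠ i} closure Dⱼ`. -/
def net (P : Params) (i : ZMod 3) : Set Pt :=
  skFrontier P (domain P i) \ ⋃ (j : ZMod 3) (_ : j ≠ i), closure (domain P j)

/-- The ping-pong table `D₀ = (Sk ∖ ⋃ᵢ closure Dᵢ) ∪ ⋃ᵢ Lᵢ`. -/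
def table (P : Params) : Set Pt :=
  (skeleton P \ ⋃ i : ZMod 3, closure (domain P i)) ∪ ⋃ i : ZMod 3, net P i

/-- The set `U = Γ.D₀`. -/
def orbitTable (P : Params) : Set Pt :=
  {y | ∃ g ∈ vietaGroup P, ∃ x ∈ table P, g x = y}

/-! ### The gcd of two real numbers -/

open Classical in
/-- Thomae's function: `1/|q|` at a rational number `p/q` in lowest terms, `0` at an irrational
number. -/
def thomae (t : ℝ) : ℝ :=
  if h : ∃ r : ℚ, (r : ℝ) = t then 1 / (h.choose.den : ℝ) else 0

theorem thomae_ratCast (r : ℚ) : thomae (r : ℝ) = 1 / (r.den : ℝ) := by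
  have h : ∃ s : ℚ, (s : ℝ) = (r : ℝ) := ⟨r, rfl⟩
  have e : h.choose = r := by exact_mod_cast h.choose_spec
  rw [thomae, dif_pos h, e]

/-- `gcd(s,t) = |s| gcd(1,t/s)` for `s ≠ 0`, and `gcd(0,t) = |t|`. -/
def realGcd (s t : ℝ) : ℝ :=
  if s = 0 then |t| else |s| * thomae (t / s)

/-! ### Special coordinates, slope and index shift -/

/-- `uⁱ₁ = x_{i+1} - x_i`. -/
def coordOne (i : ZMod 3) (x : Pt) : ℝ := x (i + 1) - x i

/-- `uⁱ₂ = x_{i-1} - x_i`. -/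
def coordTwo (i : ZMod 3) (x : Pt) : ℝ := x (i - 1) - x i

/-- The slope `uⁱ₂(x)/uⁱ₁(x) ∈ [0,∞]` of a point `x ∈ C(Xᵢ²)`, where both coordinates are
nonnegative. -/
def slope (i : ZMod 3) (x : Pt) : ℝ≥0∞ :=
  ENNReal.ofReal (coordTwo i x) / ENNReal.ofReal (coordOne i x)

/-- The transformation `T` of `[0,∞]`: `T(m) = 1/m - 1` if `m < 1`, and `T(m) = 1/(m-1)` if
`m ≥ 1`, with `1/0 = ∞` and `1/∞ = 0`. -/
def slopeMap (m : ℝ≥0∞) : ℝ≥0∞ :=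
  if m < 1 then m⁻¹ - 1 else (m - 1)⁻¹

/-- The stopping time `st(m) = inf {j > 0 : T^j(m) = 0 or ∞}`. It is a natural number when this
set is nonempty, which is the case for rational slopes; otherwise the value `0` is a convention. -/
def stoppingTime (m : ℝ≥0∞) : ℕ :=
  sInf {j : ℕ | 0 < j ∧ (slopeMap^[j] m = 0 ∨ slopeMap^[j] m = ⊤)}

open Classical in
/-- The index shift `δ(m)`: the number of `j ∈ [0, st)` with `T^j(m) ≥ 1` minus the number of
`j ∈ [0, st)` with `T^j(m) < 1`. -/
def indexShift (m : ℝ≥0∞) : ℤ :=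
  (((Finset.range (stoppingTime m)).filter fun j => 1 ≤ slopeMap^[j] m).card : ℤ) -
    (((Finset.range (stoppingTime m)).filter fun j => slopeMap^[j] m < 1).card : ℤ)

/-! ### Thresholds -/

/-- Half of an element of `ℝ ∪ {∞}`. -/
def half (t : WithTop ℝ) : WithTop ℝ := t.map fun r => r / 2

/-- For `j = 1` this is `min(0, a/2, b, c, d/2)`, and cyclically. -/
def thresholdTop (P : Params) (j : ZMod 3) : WithTop ℝ :=
  min 0 <| min (half (P.coef j)) <| min (P.coef (j + 1)) <| min (P.coef (j - 1)) (half P.d)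

theorem thresholdTop_ne_top (P : Params) (j : ZMod 3) : thresholdTop P j ≠ ⊤ :=
  ne_top_of_le_ne_top WithTop.zero_ne_top (min_le_left _ _)

/-- The threshold `Θ_j`, a real number; the index `j` is taken modulo 3. -/
def threshold (P : Params) (j : ZMod 3) : ℝ :=
  (thresholdTop P j).untop (thresholdTop_ne_top P j)

end

end TropMarkov

/-! Ping-pong, combined with the subtractive Euclidean algorithm. Write `vm P i x` for the minimum
occurring in `s_i`, so that `s_i` reflects `x i` about `vm P i x / 2`. On the skeleton, `D_i` is
then exactly the locus `2 * x i < vm P i x` (`mem_domain_iff`), and `U` can be studied through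
linear inequalities. The domains are pairwise disjoint (`lt_of_lt_vm`). Hence the orbit of a point
`q` of the closed table (outside all `D_i`) consists of the points obtained from `q` by involutions
that each enter a domain (`Reach`), and it meets the closed table only at `q`.

A point of the closed table that is missing from the table lies on two fixed curves. Such points are
the corners, with coordinate `0` at some `k` and `-g` at the other two places. The inequalities
saying that a corner lies on the skeleton and outside all domains amount to `g ≥ -Θ_k`
(`corner_spec`, `eq_corner`).

Inside a quadratic cell the descent `s_i` subtracts the smaller of the two special coordinates from
the larger one, passing to a neighbouring cell; on slopes it is `T`, and the cell index moves by
`+1` or `-1`. A negative parameter keeps the points of the domains in quadratic cells away from the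
origin, so the descent ends in the closed table (`exists_reach`). If it ends in the table, then `x ∈
U`. Otherwise it ends at a corner, whose `g` is the gcd and whose index `k` is the final cell. The
final slope `1` adds one more `+1` to `δ` without a change of cell, hence `k = i + δ - 1`.
Conversely, running Euclid backwards from a corner with `g ≥ -Θ_k` reaches every point with these
data (`reach_quadPt`). -/

namespace TropMarkov

/-! ### The skeleton seen from one involution. -/

/-- The minimum in the tropical Vieta involution, as a real number. -/
noncomputable def vm (P : Params) (i : ZMod 3) (x : Pt) : ℝ :=
  (vietaMin P i x).untop (vietaMin_ne_top P i x)

theorem coe_vm (P : Params) (i : ZMod 3) (x : Pt) : (vm P i x : WithTop ℝ) = vietaMin P i x :=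
  WithTop.coe_untop _ _

theorem tropVieta_eq (P : Params) (i : ZMod 3) (x : Pt) :
    tropVieta P i x = Function.update x i (vm P i x - x i) := rfl

theorem eq_or_eq_of_distinct {i j l : ZMod 3} (hij : i ≠ j) (hil : i ≠ l) (hjl : j ≠ l) :
    (j = i + 1 ∧ l = i - 1) ∨ (j = i - 1 ∧ l = i + 1) := by
  revert i j l; decide

theorem forall_iff_of_distinct {i j l : ZMod 3} (hij : i ≠ j) (hil : i ≠ l) (hjl : j ≠ l)
    {p : ZMod 3 → Prop} : (∀ k, p k) ↔ p i ∧ p j ∧ p l := by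
  refine ⟨fun h => ⟨h _, h _, h _⟩, fun ⟨h1, h2, h3⟩ k => ?_⟩
  have key : ∀ i j l : ZMod 3, i ≠ j → i ≠ l → j ≠ l → ∀ k, k = i ∨ k = j ∨ k = l := by decide
  rcases key i j l hij hil hjl k with rfl | rfl | rfl <;> assumption

theorem exists_iff_of_distinct {i j l : ZMod 3} (hij : i ≠ j) (hil : i ≠ l) (hjl : j ≠ l)
    {p : ZMod 3 → Prop} : (∃ k, p k) ↔ p i ∨ p j ∨ p l := by
  have := forall_iff_of_distinct hij hil hjl (p := fun k => ¬ p k)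
  rw [← not_iff_not]; push Not; exact this

theorem sum_eq_of_distinct {i j l : ZMod 3} (hij : i ≠ j) (hil : i ≠ l) (hjl : j ≠ l) (x : Pt) :
    x 1 + x 2 + x 3 = x i + x j + x l := by
  have h : ∀ s : Finset (ZMod 3), s = Finset.univ → ∑ k ∈ s, x k = ∑ k, x k := fun s hs => by rw [hs]
  have h1 := h {1, 2, 3} (by decide)
  have h2 := h {i, j, l} (by clear h h1 x; revert i j l; decide)
  rw [Finset.sum_insert (by decide), Finset.sum_pair (by decide)] at h1
  rw [Finset.sum_insert (by simp [hij, hil]), Finset.sum_pair hjl] at h2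
  linarith

theorem coe_le_add_coe_iff {r s : ℝ} {t : WithTop ℝ} :
    ((r : ℝ) : WithTop ℝ) ≤ t + (s : WithTop ℝ) ↔ ((r - s : ℝ) : WithTop ℝ) ≤ t := by
  induction t with
  | top => simp
  | coe t => norm_cast; exact sub_le_iff_le_add.symm

theorem add_coe_eq_coe_iff {r s : ℝ} {t : WithTop ℝ} :
    t + (s : WithTop ℝ) = ((r : ℝ) : WithTop ℝ) ↔ ((r - s : ℝ) : WithTop ℝ) = t := by
  induction t with
  | top => simp
  | coe t => norm_cast; constructor <;> intro h <;> linarith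

theorem le_vm_iff {i j l : ZMod 3} (hij : i ≠ j) (hil : i ≠ l) (hjl : j ≠ l)
    (P : Params) (x : Pt) (r : ℝ) :
    r ≤ vm P i x ↔ r ≤ 2 * x j ∧ r ≤ 2 * x l ∧ ((r - x j : ℝ) : WithTop ℝ) ≤ P.coef j ∧
      ((r - x l : ℝ) : WithTop ℝ) ≤ P.coef l ∧ (r : WithTop ℝ) ≤ P.d := by
  rw [← WithTop.coe_le_coe, coe_vm, vietaMin]
  simp only [le_min_iff, tropMon, coe_le_add_coe_iff, WithTop.coe_le_coe]
  rcases eq_or_eq_of_distinct hij hil hjl with ⟨rfl, rfl⟩ | ⟨rfl, rfl⟩ <;> tauto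

theorem vm_le {i j : ZMod 3} (hij : i ≠ j) (P : Params) (x : Pt) : vm P i x ≤ 2 * x j := by
  obtain ⟨l, hil, hjl⟩ : ∃ l : ZMod 3, i ≠ l ∧ j ≠ l := by revert i j; decide
  exact ((le_vm_iff hij hil hjl P x _).1 le_rfl).1

theorem vm_eq_or {i j l : ZMod 3} (hij : i ≠ j) (hil : i ≠ l) (hjl : j ≠ l)
    (P : Params) (x : Pt) :
    vm P i x = 2 * x j ∨ vm P i x = 2 * x l ∨ ((vm P i x - x j : ℝ) : WithTop ℝ) = P.coef j ∨
      ((vm P i x - x l : ℝ) : WithTop ℝ) = P.coef l ∨ (vm P i x : WithTop ℝ) = P.d := by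
  have h : vietaMin P i x = tropMon P x (Mon.sq (i + 1)) ∨ vietaMin P i x = tropMon P x (Mon.sq (i - 1))
    ∨ vietaMin P i x = tropMon P x (Mon.lin (i + 1)) ∨ vietaMin P i x = tropMon P x (Mon.lin (i - 1))
    ∨ vietaMin P i x = tropMon P x Mon.const := by
    unfold vietaMin
    grind
  rw [← coe_vm] at h
  simp only [tropMon, eq_comm (b := P.coef _ + _), add_coe_eq_coe_iff, WithTop.coe_inj] at h
  rcases eq_or_eq_of_distinct hij hil hjl with ⟨rfl, rfl⟩ | ⟨rfl, rfl⟩ <;> tauto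

theorem vm_update (P : Params) (i : ZMod 3) (x : Pt) (t : ℝ) :
    vm P i (Function.update x i t) = vm P i x := by
  have := vietaMin_update P i x t
  rw [← coe_vm, ← coe_vm] at this
  exact_mod_cast this

theorem vm_tropVieta (P : Params) (i : ZMod 3) (x : Pt) : vm P i (tropVieta P i x) = vm P i x :=
  vm_update ..

theorem tropVieta_self (P : Params) (i : ZMod 3) (x : Pt) :
    tropVieta P i x i = vm P i x - x i := by simp [tropVieta_eq]

theorem tropVieta_of_ne (P : Params) {i j : ZMod 3} (h : i ≠ j) (x : Pt) :
    tropVieta P i x j = x j := by simp [tropVieta_eq, h.symm]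

theorem tropVieta_eq_self_iff (P : Params) (i : ZMod 3) (x : Pt) :
    tropVieta P i x = x ↔ 2 * x i = vm P i x := by
  rw [tropVieta_eq, Function.update_eq_self_iff]
  constructor <;> intro h <;> linarith

theorem le_tropPoly_iff (P : Params) (x : Pt) (r : WithTop ℝ) :
    r ≤ tropPoly P x ↔ ∀ m, r ≤ tropMon P x m := by
  simp only [tropPoly, le_min_iff]
  constructor
  · rintro ⟨h1, h2, h3, h4, h5, h6, h7, h8⟩ (k | k | _ | _)
    · exact (forall_iff_of_distinct (i := 1) (j := 2) (l := 3) (by decide) (by decide) (by decide)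
        (p := fun k => r ≤ tropMon P x (Mon.sq k))).2 ⟨h1, h2, h3⟩ k
    · exact (forall_iff_of_distinct (i := 1) (j := 2) (l := 3) (by decide) (by decide) (by decide)
        (p := fun k => r ≤ tropMon P x (Mon.lin k))).2 ⟨h5, h6, h7⟩ k
    · exact h8
    · exact h4
  · intro h
    exact ⟨h _, h _, h _, h _, h _, h _, h _, h _⟩

theorem mem_skeleton_iff_mon (P : Params) (x : Pt) :
    x ∈ skeleton P ↔ (∀ m, tropMon P x Mon.prod ≤ tropMon P x m) ∧
      ∃ m, m ≠ Mon.prod ∧ tropMon P x m = tropMon P x Mon.prod := by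
  constructor
  · rintro ⟨⟨m, m', hne, h1, h2⟩, h⟩
    refine ⟨(le_tropPoly_iff P x _).1 h.le, ?_⟩
    by_cases hm : m = Mon.prod
    · exact ⟨m', fun e => hne (hm.trans e.symm), h2.trans h.symm⟩
    · exact ⟨m, hm, h1.trans h.symm⟩
  · rintro ⟨h, m, hm, e⟩
    have h' : tropMon P x Mon.prod = tropPoly P x :=
      le_antisymm ((le_tropPoly_iff P x _).2 h) ((le_tropPoly_iff P x _).1 le_rfl _)
    exact ⟨⟨m, Mon.prod, hm, e.trans h', h'⟩, h'⟩

/-- Singling out `i` groups the monomials so that `s_i` becomes visible: replacing `x i` by `vm P i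
x - x i` exchanges the conditions `x j + x l ≤ x i` and `x i + x j + x l ≤ vm P i x`, and leaves the
one on `P.coef i` alone. Invariance of the skeleton follows at once. -/
theorem mem_skeleton_iff {i j l : ZMod 3} (hij : i ≠ j) (hil : i ≠ l) (hjl : j ≠ l)
    (P : Params) (x : Pt) :
    x ∈ skeleton P ↔ x j + x l ≤ x i ∧ ((x j + x l : ℝ) : WithTop ℝ) ≤ P.coef i ∧
      x i + x j + x l ≤ vm P i x ∧
      (x j + x l = x i ∨ ((x j + x l : ℝ) : WithTop ℝ) = P.coef i ∨
        x i + x j + x l = vm P i x) := by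
  have hs := sum_eq_of_distinct hij hil hjl x
  have hsub : x i + x j + x l - x i = x j + x l := by ring
  have h1 : (∀ m, tropMon P x Mon.prod ≤ tropMon P x m) ↔
      x j + x l ≤ x i ∧ ((x j + x l : ℝ) : WithTop ℝ) ≤ P.coef i ∧ x i + x j + x l ≤ vm P i x := by
    rw [le_vm_iff hij hil hjl]
    constructor
    · intro h
      have q := fun k => h (Mon.sq k)
      have c := fun k => h (Mon.lin k)
      have d := h Mon.const
      simp only [tropMon, hs, coe_le_add_coe_iff, WithTop.coe_le_coe] at q c d
      have ci := c i
      rw [hsub] at ci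
      exact ⟨by linarith [q i], ci, q j, q l, c j, c l, d⟩
    · rintro ⟨h1, h2, h3, h4, h5, h6, h7⟩ (k | k | _ | _)
      · simp only [tropMon, hs, WithTop.coe_le_coe]
        exact (forall_iff_of_distinct hij hil hjl
          (p := fun k => x i + x j + x l ≤ 2 * x k)).2 ⟨by linarith, h3, h4⟩ k
      · simp only [tropMon, hs, coe_le_add_coe_iff]
        exact (forall_iff_of_distinct hij hil hjl (p := fun k =>
          ((x i + x j + x l - x k : ℝ) : WithTop ℝ) ≤ P.coef k)).2 ⟨by rwa [hsub], h5, h6⟩ k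
      · simpa only [tropMon, hs] using h7
      · exact le_rfl
  rw [mem_skeleton_iff_mon, h1]
  constructor
  · rintro ⟨⟨a1, a2, a3⟩, m, hm, e⟩
    refine ⟨a1, a2, a3, ?_⟩
    obtain ⟨b1, b2, b3, b4, b5⟩ := (le_vm_iff hij hil hjl P x _).1 le_rfl
    have key : ∀ r : ℝ, vm P i x ≤ r → x i + x j + x l = r → x i + x j + x l = vm P i x :=
      fun r h h' => le_antisymm a3 (h'.symm ▸ h)
    rcases m with k | k | _ | _
    · simp only [tropMon, hs, WithTop.coe_inj] at e
      rcases (exists_iff_of_distinct hij hil hjl (p := fun k => 2 * x k = x i + x j + x l)).1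
        ⟨k, e⟩ with e | e | e
      · left; linarith
      · exact .inr (.inr (key _ b1 e.symm))
      · exact .inr (.inr (key _ b2 e.symm))
    · simp only [tropMon, hs, add_coe_eq_coe_iff] at e
      rcases (exists_iff_of_distinct hij hil hjl (p := fun k =>
        ((x i + x j + x l - x k : ℝ) : WithTop ℝ) = P.coef k)).1 ⟨k, e⟩ with e | e | e
      · right; left; rwa [hsub] at e
      · rw [← e, WithTop.coe_le_coe] at b3
        exact .inr (.inr (by linarith))
      · rw [← e, WithTop.coe_le_coe] at b4
        exact .inr (.inr (by linarith))
    · simp only [tropMon, hs] at e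
      rw [e, WithTop.coe_le_coe] at b5
      exact .inr (.inr (by linarith))
    · exact absurd rfl hm
  · rintro ⟨a1, a2, a3, e⟩
    refine ⟨⟨a1, a2, a3⟩, ?_⟩
    rcases e with e | e | e
    · refine ⟨Mon.sq i, by simp, ?_⟩
      simp only [tropMon, hs, WithTop.coe_inj]; linarith
    · refine ⟨Mon.lin i, by simp, ?_⟩
      simp only [tropMon, hs, add_coe_eq_coe_iff]; rwa [hsub]
    · have := vm_eq_or hij hil hjl P x
      rw [← e] at this
      rcases this with h | h | h | h | h
      · refine ⟨Mon.sq j, by simp, ?_⟩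
        simp only [tropMon, hs, WithTop.coe_inj]; linarith
      · refine ⟨Mon.sq l, by simp, ?_⟩
        simp only [tropMon, hs, WithTop.coe_inj]; linarith
      · refine ⟨Mon.lin j, by simp, ?_⟩
        simpa only [tropMon, hs, add_coe_eq_coe_iff] using h
      · refine ⟨Mon.lin l, by simp, ?_⟩
        simpa only [tropMon, hs, add_coe_eq_coe_iff] using h
      · refine ⟨Mon.const, by simp, ?_⟩
        simpa only [tropMon, hs] using h.symm

theorem exists_distinct (i : ZMod 3) : ∃ j l : ZMod 3, i ≠ j ∧ i ≠ l ∧ j ≠ l := by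
  revert i; decide

theorem exists_third {i j : ZMod 3} (h : i ≠ j) : ∃ l : ZMod 3, i ≠ l ∧ j ≠ l := by
  revert i j; decide

theorem tropVieta_mem_skeleton {P : Params} {x : Pt} (hx : x ∈ skeleton P) (i : ZMod 3) :
    tropVieta P i x ∈ skeleton P := by
  obtain ⟨j, l, hij, hil, hjl⟩ := exists_distinct i
  rw [mem_skeleton_iff hij hil hjl] at hx ⊢
  rw [vm_tropVieta, tropVieta_self, tropVieta_of_ne P hij, tropVieta_of_ne P hil]
  obtain ⟨h1, h2, h3, h4⟩ := hx
  refine ⟨by linarith, h2, by linarith, ?_⟩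
  rcases h4 with h | h | h
  · exact .inr (.inr (by linarith))
  · exact .inr (.inl h)
  · exact .inl (by linarith)

theorem lipschitzWith_vm (P : Params) (i : ZMod 3) : LipschitzWith 2 (vm P i) := by
  obtain ⟨j, l, hij, hil, hjl⟩ := exists_distinct i
  refine LipschitzWith.of_le_add_mul 2 fun x y => ?_
  rw [← sub_le_iff_le_add, le_vm_iff hij hil hjl]
  obtain ⟨b1, b2, b3, b4, b5⟩ := (le_vm_iff hij hil hjl P x _).1 le_rfl
  have hd : ∀ k, x k - y k ≤ dist x y := fun k =>
    (le_abs_self _).trans ((Real.dist_eq (x k) (y k)).symm.le.trans (dist_le_pi_dist x y k))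
  have h0 : 0 ≤ dist x y := dist_nonneg
  have hj := hd j
  have hl := hd l
  have h2 : ((2 : NNReal) : ℝ) = 2 := rfl
  rw [h2]
  refine ⟨by linarith, by linarith, le_trans ?_ b3, le_trans ?_ b4, le_trans ?_ b5⟩ <;>
    rw [WithTop.coe_le_coe] <;> linarith

theorem continuous_vm (P : Params) (i : ZMod 3) : Continuous (vm P i) :=
  (lipschitzWith_vm P i).continuous

/-- `vm` loses at most `2t` when the coordinates are lowered by at most `t ≥ 0`. -/
theorem vm_sub_le {P : Params} {i j l : ZMod 3} (hij : i ≠ j) (hil : i ≠ l) (hjl : j ≠ l)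
    {x y : Pt} {t : ℝ} (ht : 0 ≤ t) (h1 : x j - t ≤ y j) (h2 : x l - t ≤ y l) :
    vm P i x - 2 * t ≤ vm P i y := by
  rw [le_vm_iff hij hil hjl]
  obtain ⟨b1, b2, b3, b4, b5⟩ := (le_vm_iff hij hil hjl P x _).1 le_rfl
  refine ⟨by linarith, by linarith, le_trans ?_ b3, le_trans ?_ b4, le_trans ?_ b5⟩ <;>
    rw [WithTop.coe_le_coe] <;> linarith

/-! ### Domains, their closures and the table as inequalities. -/

theorem mem_cell_sq_iff {i j l : ZMod 3} (hij : i ≠ j) (hil : i ≠ l) (hjl : j ≠ l)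
    (P : Params) (x : Pt) :
    x ∈ cell P (Mon.sq i) ↔ x j + x l = x i ∧ ((x j + x l : ℝ) : WithTop ℝ) ≤ P.coef i ∧
      2 * x i ≤ vm P i x := by
  have hs := sum_eq_of_distinct hij hil hjl x
  rw [cell, mem_ofPred_eq, mem_skeleton_iff hij hil hjl]
  simp only [tropMon, hs, WithTop.coe_inj]
  constructor
  · rintro ⟨⟨h1, h2, h3, -⟩, h⟩
    exact ⟨by linarith, h2, by linarith⟩
  · rintro ⟨h1, h2, h3⟩
    exact ⟨⟨h1.le, h2, by linarith, .inl h1⟩, by linarith⟩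

/-- The point obtained from `x` by moving the `i`-th coordinate by `2t` and the others by `t`. -/
noncomputable def quadShift (i : ZMod 3) (x : Pt) (t : ℝ) : Pt :=
  fun k => if k = i then x k + 2 * t else x k + t

theorem quadShift_self (i : ZMod 3) (x : Pt) (t : ℝ) : quadShift i x t i = x i + 2 * t := by
  simp [quadShift]

theorem quadShift_of_ne {i j : ZMod 3} (h : i ≠ j) (x : Pt) (t : ℝ) :
    quadShift i x t j = x j + t := by
  simp [quadShift, h.symm]

theorem continuous_quadShift (i : ZMod 3) (x : Pt) : Continuous (quadShift i x) := by
  refine continuous_pi fun k => ?_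
  by_cases h : k = i <;> simp only [quadShift, h, if_true, if_false] <;> fun_prop

theorem quadShift_zero (i : ZMod 3) (x : Pt) : quadShift i x 0 = x := by
  ext k; simp [quadShift]

/-- Strictness comes from pushing `x` outwards along `quadShift`, which stays in the plane of the
cell: `2 * x i` grows by `4t` but `vm P i x` by at most `2t`, and the weak inequality still holds at
the shifted point. -/
theorem of_mem_quadCellInterior {P : Params} {i j l : ZMod 3} (hij : i ≠ j) (hil : i ≠ l)
    (hjl : j ≠ l) {x : Pt} (hx : x ∈ quadCellInterior P i) :
    x ∈ skeleton P ∧ x j + x l = x i ∧ 2 * x i < vm P i x := by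
  obtain ⟨hc, hn⟩ := hx
  have hc' := (mem_cell_sq_iff hij hil hjl P x).1 hc
  refine ⟨hc.1, hc'.1, ?_⟩
  have ht : Filter.Tendsto (quadShift i x) (𝓝 0) (𝓝[quadPlane i] x) := by
    refine tendsto_nhdsWithin_iff.2 ⟨?_, .of_forall fun t => ?_⟩
    · have := (continuous_quadShift i x).tendsto 0
      rwa [quadShift_zero] at this
    · rw [quadPlane, mem_ofPred_eq, sum_eq_of_distinct hij hil hjl, quadShift_self,
        quadShift_of_ne hij, quadShift_of_ne hil]
      linarith [hc'.1]
  have hpos : ∃ᶠ t : ℝ in 𝓝 0, 0 < t :=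
    (eventually_mem_nhdsWithin : ∀ᶠ t in 𝓝[>] (0 : ℝ), t ∈ Ioi 0).frequently.filter_mono
      nhdsWithin_le_nhds
  obtain ⟨t, ht0, htc⟩ := (hpos.and_eventually (ht.eventually hn)).exists
  have h2 := ((mem_cell_sq_iff hij hil hjl P _).1 htc).2.2
  have h3 := vm_sub_le (P := P) hij hil hjl (x := quadShift i x t) (y := x) ht0.le
    (by rw [quadShift_of_ne hij]; linarith) (by rw [quadShift_of_ne hil]; linarith)
  rw [quadShift_self] at h2
  linarith

theorem isOpen_coe_lt {f : Pt → ℝ} (hf : Continuous f) (t : WithTop ℝ) :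
    IsOpen {x | ((f x : ℝ) : WithTop ℝ) < t} := by
  induction t with
  | top => simp
  | coe t => simpa only [WithTop.coe_lt_coe] using isOpen_lt hf continuous_const

theorem mem_quadCellInterior {P : Params} {i j l : ZMod 3} (hij : i ≠ j) (hil : i ≠ l)
    (hjl : j ≠ l) {x : Pt} (h1 : x j + x l = x i)
    (h2 : ((x j + x l : ℝ) : WithTop ℝ) < P.coef i) (h3 : 2 * x i < vm P i x) :
    x ∈ quadCellInterior P i := by
  refine ⟨(mem_cell_sq_iff hij hil hjl P x).2 ⟨h1, h2.le, h3.le⟩, ?_⟩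
  have e2 := (isOpen_coe_lt (f := fun x : Pt => x j + x l) (by fun_prop) (P.coef i)).mem_nhds h2
  have e3 := (isOpen_lt (f := fun x : Pt => 2 * x i) (by fun_prop) (continuous_vm P i)).mem_nhds h3
  filter_upwards [mem_nhdsWithin_of_mem_nhds e2, mem_nhdsWithin_of_mem_nhds e3,
    self_mem_nhdsWithin] with y y2 y3 y1
  rw [quadPlane, mem_ofPred_eq, sum_eq_of_distinct hij hil hjl] at y1
  exact (mem_cell_sq_iff hij hil hjl P y).2 ⟨by linarith, y2.le, y3.le⟩

/-- Moving a point of `C(Xᵢ²)` into its interior. -/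
theorem quadShift_neg_mem {P : Params} {i j l : ZMod 3} (hij : i ≠ j) (hil : i ≠ l)
    (hjl : j ≠ l) {x : Pt} (h1 : x j + x l = x i)
    (h2 : ((x j + x l : ℝ) : WithTop ℝ) ≤ P.coef i) (h3 : 2 * x i ≤ vm P i x) {t : ℝ}
    (ht : 0 < t) :
    quadShift i x (-t) ∈ quadCellInterior P i := by
  have h4 := vm_sub_le (P := P) hij hil hjl (x := x) (y := quadShift i x (-t)) ht.le
    (by rw [quadShift_of_ne hij]; linarith) (by rw [quadShift_of_ne hil]; linarith)
  refine mem_quadCellInterior hij hil hjl ?_ (lt_of_lt_of_le ?_ h2) ?_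
  · rw [quadShift_of_ne hij, quadShift_of_ne hil, quadShift_self]; linarith
  · rw [WithTop.coe_lt_coe, quadShift_of_ne hij, quadShift_of_ne hil]; linarith
  · rw [quadShift_self]; linarith

theorem mem_skeleton_update {P : Params} {i j l : ZMod 3} (hij : i ≠ j) (hil : i ≠ l)
    (hjl : j ≠ l) {x : Pt} (hx : x ∈ skeleton P) (h : 2 * x i ≤ vm P i x) {s : ℝ}
    (hs1 : x j + x l ≤ s) (hs2 : s ≤ x i) :
    Function.update x i s ∈ skeleton P := by
  rw [mem_skeleton_iff hij hil hjl] at hx ⊢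
  simp only [vm_update, Function.update_self, Function.update_of_ne hij.symm,
    Function.update_of_ne hil.symm]
  obtain ⟨a1, a2, a3, a4⟩ := hx
  refine ⟨hs1, a2, by linarith, ?_⟩
  rcases a4 with a | a | a
  · exact .inl (by linarith)
  · exact .inr (.inl a)
  · exact .inl (by linarith)

theorem mem_compl_fixedPoints {P : Params} {i : ZMod 3} {x : Pt} (hx : x ∈ skeleton P)
    (h : 2 * x i < vm P i x) :
    x ∈ skeleton P \ Function.fixedPoints (tropVieta P i) :=
  ⟨hx, fun hf => h.ne ((tropVieta_eq_self_iff P i x).1 hf)⟩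

/-- The continuous function `2 * z i - vm P i z` vanishes exactly on the fixed set, so its sign is
constant on a connected piece of the complement. Conversely, an explicit path inside the locus of
negative sign joins `x` to the interior of the cell. -/
theorem mem_domain_iff {P : Params} {i : ZMod 3} {x : Pt} :
    x ∈ domain P i ↔ x ∈ skeleton P ∧ 2 * x i < vm P i x := by
  obtain ⟨j, l, hij, hil, hjl⟩ := exists_distinct i
  constructor
  · rintro ⟨y, hy, hxy⟩
    have hx := connectedComponentIn_subset _ _ hxy
    refine ⟨hx.1, ?_⟩
    obtain ⟨y1, -, y3⟩ := of_mem_quadCellInterior hij hil hjl hy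
    have hpre : IsPreconnected (connectedComponentIn
      (skeleton P \ Function.fixedPoints (tropVieta P i)) y) := isPreconnected_connectedComponentIn
    have hcont : Continuous fun z : Pt => 2 * z i - vm P i z := by
      have := continuous_vm P i
      fun_prop
    have hymem := mem_connectedComponentIn (mem_compl_fixedPoints y1 y3)
    by_contra hcon
    obtain ⟨z, hz, hz0⟩ := hpre.intermediate_value hymem hxy hcont.continuousOn
      (show (0 : ℝ) ∈ Icc _ _ from ⟨by linarith, by linarith⟩)
    have hz' := connectedComponentIn_subset _ _ hz
    exact hz'.2 ((tropVieta_eq_self_iff P i z).2 (by linarith))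
  · rintro ⟨hx, h⟩
    obtain ⟨a1, a2, a3, -⟩ := (mem_skeleton_iff hij hil hjl P x).1 hx
    -- The path lowers `x i` until the plane of the cell is met at `w`, then follows `quadShift`
    -- into the interior of the cell.
    set w := Function.update x i (x j + x l) with hw
    have wi : w i = x j + x l := by simp [hw]
    have wj : w j = x j := by simp [hw, hij.symm]
    have wl : w l = x l := by simp [hw, hil.symm]
    have wv : vm P i w = vm P i x := vm_update ..
    have w3 : 2 * w i < vm P i w := by rw [wi, wv]; linarith
    have hy : ∀ t : ℝ, 0 < t → quadShift i w (-t) ∈ quadCellInterior P i := fun t ht =>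
      quadShift_neg_mem hij hil hjl (by rw [wi, wj, wl]) (by rw [wj, wl]; exact a2) w3.le ht
    refine ⟨_, hy 1 one_pos, ?_⟩
    have hA : IsPreconnected (quadShift i w '' Icc (-1) 0) :=
      isPreconnected_Icc.image _ (continuous_quadShift i w).continuousOn
    have hcu : Continuous fun s : ℝ => Function.update x i s :=
      continuous_const.update i continuous_id
    have hB : IsPreconnected ((fun s => Function.update x i s) '' Icc (x j + x l) (x i)) :=
      isPreconnected_Icc.image _ hcu.continuousOn
    have hwA : w ∈ quadShift i w '' Icc (-1) 0 := ⟨0, by simp, quadShift_zero i w⟩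
    have hAB := IsPreconnected.union w hwA
      (mem_image_of_mem _ (show x j + x l ∈ Icc (x j + x l) (x i) by simp [a1])) hA hB
    refine hAB.subset_connectedComponentIn (.inl ⟨-1, by simp, rfl⟩) ?_
      (.inr ⟨x i, by simp [a1], Function.update_eq_self i x⟩)
    rintro _ (⟨t, ⟨-, ht⟩, rfl⟩ | ⟨s, ⟨hs1, hs2⟩, rfl⟩)
    · rcases ht.lt_or_eq with ht | rfl
      · have := of_mem_quadCellInterior hij hil hjl (hy (-t) (by linarith))
        rw [neg_neg] at this
        exact mem_compl_fixedPoints this.1 this.2.2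
      · rw [quadShift_zero]
        exact mem_compl_fixedPoints (mem_skeleton_update hij hil hjl hx h.le le_rfl a1) w3
    · refine mem_compl_fixedPoints (x := Function.update x i s)
        (mem_skeleton_update hij hil hjl hx h.le hs1 hs2) ?_
      rw [vm_update, Function.update_self]
      linarith

theorem le_vm_of_mem_closure_domain {P : Params} {i : ZMod 3} {x : Pt}
    (hx : x ∈ closure (domain P i)) : 2 * x i ≤ vm P i x := by
  have hcl : IsClosed {x : Pt | 2 * x i ≤ vm P i x} :=
    isClosed_le (by fun_prop) (continuous_vm P i)
  exact closure_minimal (fun y hy => (mem_domain_iff.1 hy).2.le) hcl hx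

theorem mem_closure_domain_iff {P : Params} {i : ZMod 3} {x : Pt} (hx : x ∈ skeleton P) :
    x ∈ closure (domain P i) ↔ 2 * x i ≤ vm P i x := by
  refine ⟨le_vm_of_mem_closure_domain, fun h => ?_⟩
  obtain ⟨j, l, hij, hil, hjl⟩ := exists_distinct i
  obtain ⟨a1, a2, a3, -⟩ := (mem_skeleton_iff hij hil hjl P x).1 hx
  have hpos : ∀ᶠ t in 𝓝[>] (0 : ℝ), 0 < t := eventually_mem_nhdsWithin
  rcases a1.lt_or_eq with h1 | h1
  · have ht : Filter.Tendsto (fun t => Function.update x i (x i - t)) (𝓝[>] (0 : ℝ)) (𝓝 x) := by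
      have hc : Continuous fun t : ℝ => Function.update x i (x i - t) :=
        continuous_const.update i (by fun_prop)
      have := hc.tendsto 0
      simp only [sub_zero, Function.update_eq_self] at this
      exact this.mono_left nhdsWithin_le_nhds
    refine mem_closure_of_tendsto ht ?_
    filter_upwards [hpos, mem_nhdsWithin_of_mem_nhds (Iio_mem_nhds (sub_pos.2 h1))] with t t0 t1
    rw [mem_Iio] at t1
    refine mem_domain_iff.2 ⟨mem_skeleton_update hij hil hjl hx h (by linarith) (by linarith), ?_⟩
    rw [vm_update, Function.update_self]
    linarith
  · have ht : Filter.Tendsto (fun t => quadShift i x (-t)) (𝓝[>] (0 : ℝ)) (𝓝 x) := by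
      have hc : Continuous fun t : ℝ => quadShift i x (-t) :=
        (continuous_quadShift i x).comp continuous_neg
      have := hc.tendsto 0
      simp only [neg_zero, quadShift_zero] at this
      exact this.mono_left nhdsWithin_le_nhds
    refine mem_closure_of_tendsto ht ?_
    filter_upwards [hpos] with t t0
    have := of_mem_quadCellInterior hij hil hjl
      (quadShift_neg_mem hij hil hjl h1 a2 h t0)
    exact mem_domain_iff.2 ⟨this.1, this.2.2⟩

theorem mem_skFrontier_domain_iff {P : Params} {i : ZMod 3} {x : Pt} :
    x ∈ skFrontier P (domain P i) ↔ x ∈ skeleton P ∧ 2 * x i = vm P i x := by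
  constructor
  · rintro ⟨hx, h1, h2⟩
    refine ⟨hx, le_antisymm (le_vm_of_mem_closure_domain h1) ?_⟩
    have hcl : IsClosed {x : Pt | vm P i x ≤ 2 * x i} :=
      isClosed_le (continuous_vm P i) (by fun_prop)
    exact closure_minimal (fun y hy => not_lt.1 fun h => hy.2 (mem_domain_iff.2 ⟨hy.1, h⟩)) hcl h2
  · rintro ⟨hx, h⟩
    refine ⟨hx, (mem_closure_domain_iff hx).2 h.le, subset_closure ⟨hx, fun hd => ?_⟩⟩
    exact (mem_domain_iff.1 hd).2.ne h

theorem mem_table_iff {P : Params} {x : Pt} :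
    x ∈ table P ↔ x ∈ skeleton P ∧ (∀ i, vm P i x ≤ 2 * x i) ∧
      ∀ i j, i ≠ j → ¬ (2 * x i = vm P i x ∧ 2 * x j = vm P j x) := by
  simp only [table, net, mem_union, mem_sdiff, mem_iUnion, not_exists]
  constructor
  · rintro (⟨hx, h⟩ | ⟨i, hi, h⟩)
    · simp only [mem_closure_domain_iff hx, not_le] at h
      exact ⟨hx, fun i => (h i).le, fun i j _ hij => (h i).ne' hij.1⟩
    · obtain ⟨hx, hi⟩ := mem_skFrontier_domain_iff.1 hi
      simp only [mem_closure_domain_iff hx, not_le] at h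
      refine ⟨hx, fun j => ?_, fun j k hjk hh => ?_⟩
      · by_cases hj : j = i
        · exact hj ▸ hi.ge
        · exact (h j hj).le
      · by_cases hj : j = i
        · exact (h k (fun hk => hjk (hj.trans hk.symm))).ne' hh.2
        · exact (h j hj).ne' hh.1
  · rintro ⟨hx, h1, h2⟩
    by_cases hex : ∃ i, 2 * x i = vm P i x
    · obtain ⟨i, hi⟩ := hex
      refine .inr ⟨i, mem_skFrontier_domain_iff.2 ⟨hx, hi⟩, fun j hj => ?_⟩
      rw [mem_closure_domain_iff hx, not_le]
      exact (h1 j).lt_of_ne fun e => h2 i j (Ne.symm hj) ⟨hi, e.symm⟩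
    · push Not at hex
      refine .inl ⟨hx, fun i => ?_⟩
      rw [mem_closure_domain_iff hx, not_le]
      exact (h1 i).lt_of_ne (hex i).symm

/-! ### Ping-pong. -/

/-- The points obtained from `q` by a chain of involutions each of which enters a domain. -/
inductive Reach (P : Params) (q : Pt) : Pt → Prop
  | base : Reach P q q
  | step {y : Pt} (j : ZMod 3) : Reach P q y → vm P j y < 2 * y j → Reach P q (tropVieta P j y)

/-- Disjointness of the domains: `vm P j x ≤ 2 * x i < vm P i x ≤ 2 * x j`, since each minimum
contains the square of the other variable. -/
theorem lt_of_lt_vm {P : Params} {x : Pt} {i j : ZMod 3} (hij : i ≠ j)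
    (h : 2 * x i < vm P i x) : vm P j x < 2 * x j :=
  ((vm_le hij.symm P x).trans_lt h).trans_le (vm_le hij P x)

theorem vm_lt_tropVieta_iff {P : Params} {x : Pt} {i : ZMod 3} :
    vm P i (tropVieta P i x) < 2 * tropVieta P i x i ↔ 2 * x i < vm P i x := by
  rw [vm_tropVieta, tropVieta_self]
  constructor <;> intro h <;> linarith

theorem tropVieta_lt_vm_iff {P : Params} {x : Pt} {i : ZMod 3} :
    2 * tropVieta P i x i < vm P i (tropVieta P i x) ↔ vm P i x < 2 * x i := by
  rw [vm_tropVieta, tropVieta_self]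
  constructor <;> intro h <;> linarith

theorem Reach.of_tropVieta {P : Params} {q x : Pt} {i : ZMod 3}
    (h : Reach P q (tropVieta P i x)) (hx : 2 * x i < vm P i x) : Reach P q x := by
  have := h.step i (vm_lt_tropVieta_iff.2 hx)
  rwa [tropVieta_involutive P i x] at this

theorem Reach.eq_or {P : Params} {q x : Pt} (h : Reach P q x) :
    x = q ∨ ∃ j z, 2 * x j < vm P j x ∧ x = tropVieta P j z ∧ Reach P q z := by
  cases h with
  | base => exact .inl rfl
  | step j hy hlt => exact .inr ⟨j, _, tropVieta_lt_vm_iff.2 hlt, rfl, hy⟩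

theorem Reach.tropVieta_mem {P : Params} {q x : Pt} (hq : ∀ i, vm P i q ≤ 2 * q i)
    (h : Reach P q x) (i : ZMod 3) : Reach P q (tropVieta P i x) := by
  rcases lt_trichotomy (vm P i x) (2 * x i) with hlt | heq | hgt
  · exact h.step i hlt
  · rwa [(tropVieta_eq_self_iff P i x).2 heq.symm]
  · rcases h.eq_or with rfl | ⟨j, z, hj, rfl, hz⟩
    · exact absurd (hq i) hgt.not_ge
    -- A point reached by `s_j` lies in `D_j` and in no other domain, so an involution leaving a
    -- domain can only undo the last step.
    · have : i = j := by
        by_contra hij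
        exact (lt_of_lt_vm hij hgt).not_gt hj
      subst this
      rwa [tropVieta_involutive P i z]

theorem Reach.mem_of_mem_vietaGroup {P : Params} {q : Pt} (hq : ∀ i, vm P i q ≤ 2 * q i)
    {g : Equiv.Perm Pt} (hg : g ∈ vietaGroup P) : ∀ x, Reach P q x → Reach P q (g x) := by
  induction hg using Subgroup.closure_induction'' with
  | mem g hg =>
    obtain ⟨i, rfl⟩ := hg
    exact fun x hx => hx.tropVieta_mem hq i
  | inv_mem g hg =>
    obtain ⟨i, rfl⟩ := hg
    exact fun x hx => hx.tropVieta_mem hq i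
  | one => exact fun x hx => hx
  | mul g h _ _ hg hh => exact fun x hx => hg _ (hh x hx)

theorem Reach.exists_mem_vietaGroup {P : Params} {q x : Pt} (h : Reach P q x) :
    ∃ g ∈ vietaGroup P, g q = x := by
  induction h with
  | base => exact ⟨1, one_mem _, rfl⟩
  | @step y j _ _ ih =>
    obtain ⟨g, hg, rfl⟩ := ih
    exact ⟨(tropVieta_involutive P j).toPerm * g,
      mul_mem (Subgroup.subset_closure ⟨j, rfl⟩) hg, rfl⟩

theorem Reach.mem_orbitTable {P : Params} {q x : Pt} (h : Reach P q x) (hq : q ∈ table P) :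
    x ∈ orbitTable P := by
  obtain ⟨g, hg, rfl⟩ := h.exists_mem_vietaGroup
  exact ⟨g, hg, q, hq, rfl⟩

/-- The orbit of `q` meets the closed table only at `q`: every other reached point has just entered
a domain. -/
theorem Reach.notMem_orbitTable {P : Params} {q x : Pt} (h : Reach P q x)
    (hq : ∀ i, vm P i q ≤ 2 * q i) (hqt : q ∉ table P) : x ∉ orbitTable P := by
  rintro ⟨g, hg, y, hy, rfl⟩
  have h' := Reach.mem_of_mem_vietaGroup hq (inv_mem hg) _ h
  rw [← Equiv.Perm.mul_apply, inv_mul_cancel, Equiv.Perm.one_apply] at h'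
  rcases h'.eq_or with rfl | ⟨j, z, hj, -, -⟩
  · exact hqt hy
  · exact ((mem_table_iff.1 hy).2.1 j).not_gt hj

/-! ### Corners: the points of the closed table that the table omits. -/

/-- The point with coordinate `0` at `k` and `-g` elsewhere. -/
def corner (k : ZMod 3) (g : ℝ) : Pt := fun j => if j = k then 0 else -g

theorem corner_self (k : ZMod 3) (g : ℝ) : corner k g k = 0 := by simp [corner]

theorem corner_of_ne {k j : ZMod 3} (h : k ≠ j) (g : ℝ) : corner k g j = -g := by
  simp [corner, h.symm]

theorem coe_half_iff {r : ℝ} {t : WithTop ℝ} :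
    (r : WithTop ℝ) ≤ half t ↔ ((2 * r : ℝ) : WithTop ℝ) ≤ t := by
  induction t with
  | top => simp [half]
  | coe t =>
    rw [half, WithTop.map_coe, WithTop.coe_le_coe, WithTop.coe_le_coe]
    constructor <;> intro h <;> linarith

theorem neg_threshold_le_iff {k i j : ZMod 3} (hki : k ≠ i) (hkj : k ≠ j) (hij : i ≠ j)
    (P : Params) (g : ℝ) : -threshold P k ≤ g ↔ 0 ≤ g ∧ ((-(2 * g) : ℝ) : WithTop ℝ) ≤ P.coef k ∧
      ((-g : ℝ) : WithTop ℝ) ≤ P.coef i ∧ ((-g : ℝ) : WithTop ℝ) ≤ P.coef j ∧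
      ((-(2 * g) : ℝ) : WithTop ℝ) ≤ P.d := by
  have h0 : (0 : WithTop ℝ) = ((0 : ℝ) : WithTop ℝ) := rfl
  rw [neg_le, ← WithTop.coe_le_coe, threshold, WithTop.coe_untop, thresholdTop]
  simp only [le_min_iff, coe_half_iff, h0, WithTop.coe_le_coe, mul_neg]
  rw [show -g ≤ 0 ↔ 0 ≤ g by constructor <;> intro h <;> linarith]
  rcases eq_or_eq_of_distinct hki hkj hij with ⟨rfl, rfl⟩ | ⟨rfl, rfl⟩ <;> tauto

/-- At the corner the product monomial equals `-2g`, as do the squares of `x i` and `x j`. The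
threshold inequality says precisely that no other monomial is smaller. -/
theorem corner_spec {k i j : ZMod 3} (hki : k ≠ i) (hkj : k ≠ j) (hij : i ≠ j)
    {P : Params} {g : ℝ} (h : -threshold P k ≤ g) :
    corner k g ∈ skeleton P ∧ vm P i (corner k g) = -(2 * g) ∧ vm P j (corner k g) = -(2 * g) ∧
      vm P k (corner k g) = -(2 * g) := by
  obtain ⟨h0, h1, h2, h3, h4⟩ := (neg_threshold_le_iff hki hkj hij P g).1 h
  have ck := corner_self k g
  have ci := corner_of_ne hki g
  have cj := corner_of_ne hkj g
  have e1 : -(2 * g) - -g = -g := by ring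
  have vi : vm P i (corner k g) = -(2 * g) := by
    refine le_antisymm ((vm_le hij P _).trans (by rw [cj]; linarith)) ?_
    rw [le_vm_iff hij hki.symm hkj.symm, ck, cj, sub_zero, e1]
    exact ⟨by linarith, by linarith, h3, h1, h4⟩
  have vj : vm P j (corner k g) = -(2 * g) := by
    refine le_antisymm ((vm_le hij.symm P _).trans (by rw [ci]; linarith)) ?_
    rw [le_vm_iff hij.symm hkj.symm hki.symm, ck, ci, sub_zero, e1]
    exact ⟨by linarith, by linarith, h2, h1, h4⟩
  have vk : vm P k (corner k g) = -(2 * g) := by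
    refine le_antisymm ((vm_le hki P _).trans (by rw [ci]; linarith)) ?_
    rw [le_vm_iff hki hkj hij, ci, cj, e1]
    exact ⟨by linarith, by linarith, h2, h3, h4⟩
  refine ⟨(mem_skeleton_iff hij hki.symm hkj.symm P _).2 ?_, vi, vj, vk⟩
  rw [ci, cj, ck, vi, add_zero]
  exact ⟨le_rfl, h2, by linarith, .inl rfl⟩

theorem corner_closed_table {k : ZMod 3} {P : Params} {g : ℝ} (h : -threshold P k ≤ g) :
    (∀ i, vm P i (corner k g) ≤ 2 * corner k g i) ∧ corner k g ∉ table P := by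
  obtain ⟨i, j, hki, hkj, hij⟩ := exists_distinct k
  obtain ⟨-, vi, vj, vk⟩ := corner_spec hki hkj hij h
  have h0 := ((neg_threshold_le_iff hki hkj hij P g).1 h).1
  have ck := corner_self k g
  have ci := corner_of_ne hki g
  have cj := corner_of_ne hkj g
  refine ⟨(forall_iff_of_distinct hki hkj hij).2
    ⟨by rw [vk, ck]; linarith, by rw [vi, ci]; linarith, by rw [vj, cj]; linarith⟩, fun ht => ?_⟩
  exact (mem_table_iff.1 ht).2.2 i j hij ⟨by rw [vi, ci]; ring, by rw [vj, cj]; ring⟩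

theorem eq_corner {P : Params} {q : Pt} (hq : q ∈ skeleton P) (h : ∀ i, vm P i q ≤ 2 * q i)
    (hqt : q ∉ table P) : ∃ k g, -threshold P k ≤ g ∧ q = corner k g := by
  have : ∃ i j, i ≠ j ∧ 2 * q i = vm P i q ∧ 2 * q j = vm P j q := by
    by_contra hcon
    push Not at hcon
    exact hqt (mem_table_iff.2 ⟨hq, h, fun i j hij hh => hcon i j hij hh.1 hh.2⟩)
  obtain ⟨i, j, hij, ei, ej⟩ := this
  obtain ⟨k, hik, hjk⟩ := exists_third hij
  have h1 := vm_le hij P q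
  have h2 := vm_le hij.symm P q
  have hqq : q i = q j := by linarith
  have hk := vm_le hik P q
  obtain ⟨a1, a2, a3, a4⟩ := (mem_skeleton_iff hij hik hjk P q).1 hq
  obtain ⟨b1, b2, b3, b4, b5⟩ := (le_vm_iff hij hik hjk P q _).1 ei.le
  obtain ⟨c1, c2, c3, c4, c5⟩ := (le_vm_iff hij.symm hjk hik P q _).1 ej.le
  have e1 : 2 * q i - q j = q i := by linarith
  have e2 : 2 * q j - q i = q i := by linarith
  rw [e1] at b3
  rw [e2] at c3
  -- Each way of attaining the minimum forces this. On the wall of `P.coef i`, the bound from `vm P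
  -- j q` gives `q k ≥ 0` and the skeleton inequality gives `q k ≤ 0`.
  have hk0 : q k = 0 := by
    rcases a4 with a | a | a
    · linarith
    · rw [← a, WithTop.coe_le_coe] at c3
      linarith
    · linarith
  rw [hk0, sub_zero] at b4
  refine ⟨k, -q i, (neg_threshold_le_iff hik.symm hjk.symm hij P _).2
    ⟨by linarith, ?_, ?_, ?_, ?_⟩, ?_⟩
  · rwa [mul_neg, neg_neg]
  · rwa [neg_neg]
  · rwa [neg_neg]
  · rwa [mul_neg, neg_neg]
  · funext l
    refine (forall_iff_of_distinct hik.symm hjk.symm hij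
      (p := fun l => q l = corner k (-q i) l)).2 ⟨?_, ?_, ?_⟩ l
    · rw [corner_self, hk0]
    · rw [corner_of_ne hik.symm, neg_neg]
    · rw [corner_of_ne hjk.symm, neg_neg, hqq]

/-! ### Descent from a quadratic cell to the closed table. -/

/-- On the cell `C(Xᵢ²)` the involution `s_j`, `j ≠ i`, is determined by `xᵢ` alone. -/
theorem vm_eq_of_quad {P : Params} {i j l : ZMod 3} (hij : i ≠ j) (hil : i ≠ l) (hjl : j ≠ l)
    {x : Pt} (hx : x ∈ skeleton P) (h : x j + x l = x i) : vm P j x = 2 * x i := by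
  refine le_antisymm (vm_le hij.symm P x) ?_
  obtain ⟨-, a2, a3, -⟩ := (mem_skeleton_iff hij hil hjl P x).1 hx
  obtain ⟨b1, b2, b3, b4, b5⟩ := (le_vm_iff hij hil hjl P x _).1 a3
  rw [le_vm_iff hij.symm hjl hil]
  rw [show x i + x j + x l = 2 * x i by linarith] at *
  refine ⟨le_rfl, b2, ?_, b4, b5⟩
  rwa [show 2 * x i - x i = x j + x l by linarith]

/-- After an involution `s_i` at a wall `C(Xᵢ)` no further descent is possible. -/
theorem vm_le_of_wall {P : Params} {i : ZMod 3} {j l : ZMod 3} (hij : i ≠ j) (hil : i ≠ l)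
    (hjl : j ≠ l) {x : Pt} (hx : x ∈ skeleton P)
    (hw : ((x j + x l : ℝ) : WithTop ℝ) = P.coef i) :
    vm P j (tropVieta P i x) ≤ 2 * tropVieta P i x j := by
  by_contra! hcon
  obtain ⟨a1, -, -, -⟩ := (mem_skeleton_iff hij hil hjl P x).1 hx
  obtain ⟨-, -, b3, -, -⟩ := (le_vm_iff hij.symm hjl hil P _ _).1 (le_refl (vm P j (tropVieta P i x)))
  rw [← hw, WithTop.coe_le_coe, tropVieta_self] at b3
  rw [tropVieta_of_ne P hij] at hcon
  have := vm_le hij P x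
  linarith

/-- This is where negativity of some parameter enters the descent: it bounds the relevant points
away from the origin, which makes Euclid stop even at irrational slopes. -/
theorem exists_distance_bound {P : Params} (h : P.d < 0 ∨ ∃ k, P.coef k < 0) :
    ∃ ε : ℝ, 0 < ε ∧ ∀ {i j l : ZMod 3}, i ≠ j → i ≠ l → j ≠ l → ∀ x ∈ skeleton P,
      x j + x l = x i → 2 * x i < vm P i x → ε < -x i := by
  have key : ∀ t : WithTop ℝ, t < 0 → ∃ r : ℝ, t = r ∧ r < 0 := fun t ht => by
    induction t with
    | top => simp at ht
    | coe t => exact ⟨t, rfl, by exact_mod_cast ht⟩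
  rcases h with h | ⟨k, h⟩
  all_goals
    obtain ⟨r, hr, hr0⟩ := key _ h
    -- Each monomial bound yields at least `-x i ≥ -r / 2`; the smaller constant makes the
    -- inequality strict.
    refine ⟨-r / 4, by linarith, fun {i j l} hij hil hjl x hx hs hlt => ?_⟩
    obtain ⟨a1, a2, a3, -⟩ := (mem_skeleton_iff hij hil hjl P x).1 hx
    obtain ⟨b1, b2, b3, b4, b5⟩ := (le_vm_iff hij hil hjl P x _).1 a3
    have h1 := vm_le hij P x
    have h2 := vm_le hil P x
  · rw [hr, WithTop.coe_le_coe] at b5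
    linarith
  · have : k = i ∨ k = j ∨ k = l :=
      (exists_iff_of_distinct hij hil hjl (p := fun m => k = m)).1 ⟨k, rfl⟩
    rcases this with rfl | rfl | rfl
    · rw [hr, WithTop.coe_le_coe] at a2
      linarith
    · rw [hr, WithTop.coe_le_coe] at b3
      linarith
    · rw [hr, WithTop.coe_le_coe] at b4
      linarith

/-- After `s_i` a point of `D_j` lies either in `C(X_j²)`, where Euclid continues, or on the wall of
`P.coef j`, where one more step `s_j` finishes. Attaining the minimum in `vm P j` is incompatible
with lying in `D_j`. -/
theorem quad_descent {P : Params} {i j l : ZMod 3} (hij : i ≠ j) (hil : i ≠ l) (hjl : j ≠ l)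
    {x : Pt} (hx : x ∈ skeleton P)
    (hj : 2 * tropVieta P i x j < vm P j (tropVieta P i x)) :
    (∀ k, vm P k (tropVieta P j (tropVieta P i x)) ≤ 2 * tropVieta P j (tropVieta P i x) k) ∨
      tropVieta P i x i + tropVieta P i x l = tropVieta P i x j := by
  have hx' := tropVieta_mem_skeleton hx i
  obtain ⟨a1, -, a3, a4⟩ := (mem_skeleton_iff hij.symm hjl hil P _).1 hx'
  rcases a4 with a | a | a
  · exact .inr a
  · refine .inl ((forall_iff_of_distinct hij.symm hjl hil).2 ⟨?_, ?_, ?_⟩)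
    · exact (vm_lt_tropVieta_iff.2 hj).le
    · exact vm_le_of_wall hij.symm hjl hil hx' a
    · exact vm_le_of_wall hjl hij.symm hil.symm hx' (by rwa [add_comm])
  · linarith

/-- Subtractive Euclid on the pair `(-x j, -x l)` with a double induction: `n` measures the size of
`-x i`, and `k` bounds the two ratios, hence the number of subtractions before the size drops by a
factor `3 / 2`. -/
theorem exists_reach_of_bounded {P : Params} {ε : ℝ}
    (hb : ∀ {i j l : ZMod 3}, i ≠ j → i ≠ l → j ≠ l → ∀ x ∈ skeleton P,
      x j + x l = x i → 2 * x i < vm P i x → ε < -x i) (n : ℕ) :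
    ∀ (k : ℕ) {i j l : ZMod 3}, i ≠ j → i ≠ l → j ≠ l → ∀ x ∈ skeleton P,
      x j + x l = x i → 2 * x i < vm P i x → -x i ≤ ε * (3 / 2) ^ n →
      -x j ≤ k * -x l → -x l ≤ k * -x j →
      ∃ q ∈ skeleton P, (∀ m, vm P m q ≤ 2 * q m) ∧ Reach P q x := by
  induction n with
  | zero =>
    intro k i j l hij hil hjl x hx hs hlt hn
    have := hb hij hil hjl x hx hs hlt
    simp only [pow_zero, mul_one] at hn
    linarith
  | succ n ihn =>
    intro k
    induction k with
    | zero =>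
      intro i j l hij hil hjl x hx hs hlt _ h1 _
      have := vm_le hil P x
      simp only [Nat.cast_zero, zero_mul] at h1
      linarith
    | succ k ihk =>
      intro i j l hij hil hjl x hx hs hlt hn h1 h2
      have hx' := tropVieta_mem_skeleton hx i
      have main : ∀ {j l : ZMod 3}, i ≠ j → i ≠ l → j ≠ l → x j + x l = x i →
          -x j ≤ ((k + 1 : ℕ) : ℝ) * -x l → -x l ≤ ((k + 1 : ℕ) : ℝ) * -x j →
          2 * tropVieta P i x j < vm P j (tropVieta P i x) →
          ∃ q ∈ skeleton P, (∀ m, vm P m q ≤ 2 * q m) ∧ Reach P q x := by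
        intro j l hij hil hjl hs h1 h2 hj
        have e1 := vm_le hij P x
        have e2 := vm_le hil P x
        rcases quad_descent hij hil hjl hx hj with h | h
        · exact ⟨_, tropVieta_mem_skeleton hx' j, h,
            (Reach.base.of_tropVieta hj).of_tropVieta hlt⟩
        · have hvj := vm_le hjl P (tropVieta P i x)
          have ej := tropVieta_of_ne P hij x
          have el := tropVieta_of_ne P hil x
          have hi : -tropVieta P i x i = -x j - -x l := by linarith
          suffices H : ∃ q ∈ skeleton P, (∀ m, vm P m q ≤ 2 * q m) ∧ Reach P q (tropVieta P i x) by
            obtain ⟨q, q1, q2, q3⟩ := H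
            exact ⟨q, q1, q2, q3.of_tropVieta hlt⟩
          push_cast at h1 h2
          have hl0 : 0 < -x l := by linarith
          have hd0 : 0 < -x j - -x l := by linarith
          -- If `-x j < 2 * -x l`, then `-x i = -x j + -x l` exceeds `3 / 2` times the new size `-x
          -- j`, so `n` drops and a fresh ratio bound is chosen. Otherwise one subtraction lowers
          -- the ratio bound by one.
          rcases lt_or_ge (-x j) (2 * -x l) with hlt2 | hge
          · have hbn : -tropVieta P i x j ≤ ε * (3 / 2) ^ n := by
              rw [pow_succ] at hn
              rw [ej]
              linarith
            obtain ⟨m1, hm1⟩ := exists_nat_ge ((-x j - -x l) / -x l)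
            obtain ⟨m2, hm2⟩ := exists_nat_ge (-x l / (-x j - -x l))
            rw [div_le_iff₀ hl0] at hm1
            rw [div_le_iff₀ hd0] at hm2
            refine ihn (max m1 m2) hij.symm hjl hil _ hx' h hj hbn ?_ ?_
            · rw [hi, el]
              refine hm1.trans (mul_le_mul_of_nonneg_right ?_ hl0.le)
              exact_mod_cast le_max_left _ _
            · rw [hi, el]
              refine hm2.trans (mul_le_mul_of_nonneg_right ?_ hd0.le)
              exact_mod_cast le_max_right _ _
          · refine ihk hij.symm hjl hil _ hx' h hj (by rw [ej]; linarith) ?_ ?_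
            · rw [hi, el]; linarith
            · rw [hi, el]
              rcases Nat.eq_zero_or_pos k with rfl | hk
              · simp only [Nat.cast_zero, zero_add, one_mul] at h1
                linarith
              · have : (1 : ℝ) ≤ k := by exact_mod_cast hk
                nlinarith
      by_cases hc : ∀ m, vm P m (tropVieta P i x) ≤ 2 * tropVieta P i x m
      · exact ⟨_, hx', hc, Reach.base.of_tropVieta hlt⟩
      · push Not at hc
        rcases (exists_iff_of_distinct hij hil hjl).1 hc with h | h | h
        · exact absurd (vm_lt_tropVieta_iff.2 hlt) h.not_gt
        · exact main hij hil hjl hs h1 h2 h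
        · exact main hil hij hjl.symm (by linarith) h2 h1 h

/-- Every point of a domain in a quadratic cell descends to the closed ping-pong table. -/
theorem exists_reach {P : Params} (h : P.d < 0 ∨ ∃ k, P.coef k < 0) {i j l : ZMod 3}
    (hij : i ≠ j) (hil : i ≠ l) (hjl : j ≠ l) {x : Pt} (hx : x ∈ skeleton P)
    (hs : x j + x l = x i) (hlt : 2 * x i < vm P i x) :
    ∃ q ∈ skeleton P, (∀ m, vm P m q ≤ 2 * q m) ∧ Reach P q x := by
  obtain ⟨ε, hε, hb⟩ := exists_distance_bound h
  obtain ⟨n, hn⟩ := pow_unbounded_of_one_lt (-x i / ε) (by norm_num : (1 : ℝ) < 3 / 2)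
  rw [div_lt_iff₀' hε] at hn
  have e1 := vm_le hij P x
  have e2 := vm_le hil P x
  have hj0 : 0 < -x j := by linarith
  have hl0 : 0 < -x l := by linarith
  obtain ⟨m1, hm1⟩ := exists_nat_ge (-x j / -x l)
  obtain ⟨m2, hm2⟩ := exists_nat_ge (-x l / -x j)
  rw [div_le_iff₀ hl0] at hm1
  rw [div_le_iff₀ hj0] at hm2
  refine exists_reach_of_bounded hb n (max m1 m2) hij hil hjl x hx hs hlt hn.le ?_ ?_
  · refine hm1.trans (mul_le_mul_of_nonneg_right ?_ hl0.le)
    exact_mod_cast le_max_left _ _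
  · refine hm2.trans (mul_le_mul_of_nonneg_right ?_ hj0.le)
    exact_mod_cast le_max_right _ _

/-! ### The real gcd -/

/-- `s` and `t` are coprime integer multiples of `g`. -/
def CoprimeMultiples (s t g : ℝ) : Prop := ∃ q p : ℤ, IsCoprime q p ∧ s = q * g ∧ t = p * g

/-- This unimodular change of variables, of order three, is the passage from the special coordinates
at `i` to those at `i + 1`. -/
theorem CoprimeMultiples.rotate {s t g : ℝ} (h : CoprimeMultiples s t g) :
    CoprimeMultiples (t - s) (-s) g := by
  obtain ⟨q, p, ⟨a, b, hab⟩, rfl, rfl⟩ := h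
  exact ⟨p - q, -q, ⟨b, -(a + b), by linarith⟩, by push_cast; ring, by push_cast; ring⟩

theorem thomae_div_of_coprime {q p : ℤ} (hq : q ≠ 0) (h : IsCoprime q p) :
    thomae ((p : ℝ) / q) = 1 / |(q : ℝ)| := by
  have key : ∀ n : ℤ, ∀ m : ℤ, 0 < n → IsCoprime n m → thomae ((m : ℝ) / n) = 1 / (n : ℝ) := by
    intro n m hn hc
    have h1 : ((((m : ℚ) / n : ℚ)) : ℝ) = (m : ℝ) / n := by push_cast; rfl
    have h2 : ((((m : ℚ) / n : ℚ).den : ℤ)) = n :=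
      Rat.den_div_eq_of_coprime hn (Int.isCoprime_iff_gcd_eq_one.1 hc.symm)
    rw [← h1, thomae_ratCast]
    congr 1
    exact_mod_cast h2
  rcases lt_or_gt_of_ne hq with hq | hq
  · have := key (-q) (-p) (by omega) h.neg_neg
    rw [abs_of_neg (by exact_mod_cast hq)]
    push_cast at this
    rwa [neg_div_neg_eq] at this
  · rw [abs_of_pos (by exact_mod_cast hq)]
    exact key q p hq h

theorem CoprimeMultiples.realGcd_eq {s t g : ℝ} (h : CoprimeMultiples s t g) :
    realGcd s t = |g| := by
  obtain ⟨q, p, hc, rfl, rfl⟩ := h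
  unfold realGcd
  by_cases hg : g = 0
  · simp [hg]
  by_cases hq : q = 0
  · subst hq
    rw [isCoprime_zero_left, Int.isUnit_iff] at hc
    rcases hc with rfl | rfl <;> simp
  · have hq' : (q : ℝ) ≠ 0 := by exact_mod_cast hq
    rw [if_neg (mul_ne_zero hq' hg), mul_div_mul_right _ _ hg, thomae_div_of_coprime hq hc, abs_mul]
    have := abs_ne_zero.2 hq'
    field_simp

theorem exists_coprimeMultiples {s t : ℝ} (h : realGcd s t ≠ 0) :
    ∃ g, CoprimeMultiples s t g := by
  unfold realGcd at h
  split_ifs at h with hs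
  · exact ⟨t, 0, 1, isCoprime_one_right, by simp [hs], by simp⟩
  · have ht := right_ne_zero_of_mul h
    unfold thomae at ht
    split_ifs at ht with hr
    · obtain ⟨r, hr⟩ := hr
      have hd : (r.den : ℝ) ≠ 0 := by exact_mod_cast r.den_nz
      refine ⟨s / r.den, r.den, r.num, ?_, ?_, ?_⟩
      · exact (Int.isCoprime_iff_gcd_eq_one.2 (show r.num.gcd r.den = 1 from r.reduced)).symm
      · push_cast; field_simp
      · rw [Rat.cast_def] at hr
        field_simp at hr ⊢
        linarith
    · exact absurd rfl ht

theorem realGcd_congr {s t s' t' : ℝ} (h : ∀ g, CoprimeMultiples s t g ↔ CoprimeMultiples s' t' g) :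
    realGcd s t = realGcd s' t' := by
  by_cases hg : ∃ g, CoprimeMultiples s t g
  · obtain ⟨g, hg⟩ := hg
    rw [hg.realGcd_eq, ((h g).1 hg).realGcd_eq]
  · have h1 : realGcd s t = 0 := by
      by_contra hc; exact hg (exists_coprimeMultiples hc)
    have h2 : realGcd s' t' = 0 := by
      by_contra hc
      obtain ⟨g, hg'⟩ := exists_coprimeMultiples hc
      exact hg ⟨g, (h g).2 hg'⟩
    rw [h1, h2]

theorem realGcd_rotate (s t : ℝ) : realGcd (t - s) (-s) = realGcd s t := by
  refine realGcd_congr fun g => ⟨fun h => ?_, fun h => h.rotate⟩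
  have := h.rotate.rotate
  convert this using 1 <;> ring

theorem realGcd_coord (i : ZMod 3) (x : Pt) :
    realGcd (coordOne i x) (coordTwo i x) = realGcd (x 1 - x 3) (x 2 - x 3) := by
  have h : ∀ j : ZMod 3, realGcd (coordOne (j + 1) x) (coordTwo (j + 1) x) =
      realGcd (coordOne j x) (coordTwo j x) := by
    intro j
    rw [← realGcd_rotate (coordOne j x)]
    simp only [coordOne, coordTwo]
    have e1 : j + 1 + 1 = j - 1 := by revert j; decide
    have e2 : j + 1 - 1 = j := by ring
    rw [e1, e2]
    congr 1 <;> ring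
  have h3 : realGcd (coordOne 3 x) (coordTwo 3 x) = realGcd (x 1 - x 3) (x 2 - x 3) := rfl
  have h1 := (h 3).trans h3
  have h2 := (h (3 + 1)).trans h1
  exact (forall_iff_of_distinct (i := 3) (j := 3 + 1) (l := 3 + 1 + 1) (by decide) (by decide)
    (by decide) (p := fun i => realGcd (coordOne i x) (coordTwo i x) = _)).2 ⟨h3, h1, h2⟩ i

theorem realGcd_natMul {p q : ℕ} (h : p.Coprime q) {g : ℝ} (hg : 0 < g) :
    realGcd (q * g) (p * g) = g := by
  have : CoprimeMultiples (q * g) (p * g) g :=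
    ⟨q, p, Nat.isCoprime_iff_coprime.2 h.symm, by simp, by simp⟩
  rw [this.realGcd_eq, abs_of_pos hg]

theorem exists_natMul_of_realGcd_pos {s t : ℝ} (hs : 0 < s) (ht : 0 < t) (h : 0 < realGcd s t) :
    ∃ p q : ℕ, 0 < p ∧ 0 < q ∧ p.Coprime q ∧ s = q * realGcd s t ∧ t = p * realGcd s t := by
  obtain ⟨g, hg⟩ := exists_coprimeMultiples h.ne'
  have e := hg.realGcd_eq
  obtain ⟨q, p, hc, h1, h2⟩ := hg
  have hg0 : g ≠ 0 := by rintro rfl; simp at h1; exact hs.ne' h1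
  have habs : ∀ (u : ℝ) (n : ℤ), 0 < u → u = n * g → u = (n.natAbs : ℝ) * |g| ∧ 0 < n.natAbs := by
    intro u n hu hn
    refine ⟨?_, Int.natAbs_pos.2 ?_⟩
    · rw [Nat.cast_natAbs, Int.cast_abs, ← abs_mul, ← hn, abs_of_pos hu]
    · rintro rfl; simp at hn; exact hu.ne' hn
  rw [e]
  refine ⟨p.natAbs, q.natAbs, (habs t p ht h2).2, (habs s q hs h1).2, ?_, (habs s q hs h1).1,
    (habs t p ht h2).1⟩
  exact Int.isCoprime_iff_gcd_eq_one.1 hc.symm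

/-! ### The index shift -/

/-- The orbit of `m` under `T` meets `{0, ∞}` at a positive time. -/
def Terminates (m : ℝ≥0∞) : Prop := ∃ j, 0 < j ∧ (slopeMap^[j] m = 0 ∨ slopeMap^[j] m = ⊤)

theorem Terminates.of_slopeMap {m : ℝ≥0∞} (h : Terminates (slopeMap m)) : Terminates m := by
  obtain ⟨j, h0, h⟩ := h
  exact ⟨j + 1, j.succ_pos, by rwa [Function.iterate_succ_apply]⟩

/-- The time `0` is excluded from the infimum, so the recursion would fail if `slopeMap m` were
already `0` or `∞`; this is what `h0` and `h1` rule out. -/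
theorem stoppingTime_eq_succ {m : ℝ≥0∞} (h : Terminates (slopeMap m)) (h0 : slopeMap m ≠ 0)
    (h1 : slopeMap m ≠ ⊤) : stoppingTime m = stoppingTime (slopeMap m) + 1 := by
  refine le_antisymm (Nat.sInf_le ?_) ?_
  · obtain ⟨a, b⟩ := Nat.sInf_mem h
    exact ⟨Nat.succ_pos _, by rwa [Function.iterate_succ_apply]⟩
  · obtain ⟨a, b⟩ := Nat.sInf_mem h.of_slopeMap
    change 0 < stoppingTime m at a
    change slopeMap^[stoppingTime m] m = 0 ∨ slopeMap^[stoppingTime m] m = ⊤ at b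
    obtain ⟨n, hn⟩ := Nat.exists_eq_succ_of_ne_zero a.ne'
    rw [hn] at b ⊢
    rw [Function.iterate_succ_apply] at b
    refine Nat.succ_le_succ (Nat.sInf_le ⟨Nat.pos_of_ne_zero ?_, b⟩)
    rintro rfl
    exact b.elim h0 h1

open Classical in
theorem indexShift_eq_sum (m : ℝ≥0∞) : indexShift m =
    ∑ j ∈ Finset.range (stoppingTime m), if 1 ≤ slopeMap^[j] m then (1 : ℤ) else -1 := by
  unfold indexShift
  rw [Finset.card_filter, Finset.card_filter, Nat.cast_sum, Nat.cast_sum, ← Finset.sum_sub_distrib]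
  refine Finset.sum_congr rfl fun j _ => ?_
  rcases le_or_gt 1 (slopeMap^[j] m) with h | h
  · simp [h, h.not_gt]
  · simp [h, h.not_ge]

theorem indexShift_of_one_le {m : ℝ≥0∞} (h : Terminates (slopeMap m)) (h0 : slopeMap m ≠ 0)
    (h1 : slopeMap m ≠ ⊤) (hm : 1 ≤ m) : indexShift m = indexShift (slopeMap m) + 1 := by
  rw [indexShift_eq_sum, indexShift_eq_sum, stoppingTime_eq_succ h h0 h1, Finset.sum_range_succ']
  rw [if_pos (show 1 ≤ slopeMap^[0] m from hm)]
  rfl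

theorem indexShift_of_lt_one {m : ℝ≥0∞} (h : Terminates (slopeMap m)) (h0 : slopeMap m ≠ 0)
    (h1 : slopeMap m ≠ ⊤) (hm : m < 1) : indexShift m = indexShift (slopeMap m) - 1 := by
  rw [indexShift_eq_sum, indexShift_eq_sum, stoppingTime_eq_succ h h0 h1, Finset.sum_range_succ']
  rw [if_neg (show ¬ 1 ≤ slopeMap^[0] m from hm.not_ge)]
  rfl

theorem slopeMap_one : slopeMap 1 = ⊤ := by simp [slopeMap]

theorem indexShift_one : indexShift 1 = 1 := by
  have : stoppingTime 1 = 1 := by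
    refine le_antisymm (Nat.sInf_le ⟨one_pos, .inr slopeMap_one⟩) ?_
    exact (Nat.sInf_mem (s := {j : ℕ | 0 < j ∧ (slopeMap^[j] 1 = 0 ∨ slopeMap^[j] 1 = ⊤)})
      ⟨1, one_pos, .inr slopeMap_one⟩).1
  unfold indexShift
  rw [this]
  simp [Finset.filter_singleton]

theorem slopeMap_add_div {r q : ℕ} (hr : 0 < r) (hq : 0 < q) :
    slopeMap (((r + q : ℕ) : ℝ≥0∞) / q) = (q : ℝ≥0∞) / r ∧ 1 ≤ ((r + q : ℕ) : ℝ≥0∞) / q := by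
  have hq0 : (q : ℝ≥0∞) ≠ 0 := by exact_mod_cast hq.ne'
  have hqt : (q : ℝ≥0∞) ≠ ⊤ := ENNReal.natCast_ne_top q
  have hr0 : (r : ℝ≥0∞) ≠ 0 := by exact_mod_cast hr.ne'
  have e : ((r + q : ℕ) : ℝ≥0∞) / q = r / q + 1 := by
    push_cast
    rw [ENNReal.add_div, ENNReal.div_self hq0 hqt]
  have h1 : 1 ≤ ((r + q : ℕ) : ℝ≥0∞) / q := by rw [e]; exact le_add_self
  refine ⟨?_, h1⟩
  rw [slopeMap, if_neg h1.not_gt, e, ENNReal.add_sub_cancel_right ENNReal.one_ne_top,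
    ENNReal.inv_div (.inl hqt) (.inl hq0)]

theorem slopeMap_div_add {p r : ℕ} (hp : 0 < p) (hr : 0 < r) :
    slopeMap ((p : ℝ≥0∞) / (p + r : ℕ)) = (r : ℝ≥0∞) / p ∧ (p : ℝ≥0∞) / (p + r : ℕ) < 1 := by
  have hp0 : (p : ℝ≥0∞) ≠ 0 := by exact_mod_cast hp.ne'
  have hpt : (p : ℝ≥0∞) ≠ ⊤ := ENNReal.natCast_ne_top p
  have h1 : (p : ℝ≥0∞) / (p + r : ℕ) < 1 := by
    rw [ENNReal.div_lt_iff (.inl (by exact_mod_cast (by omega : p + r ≠ 0)))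
      (.inl (ENNReal.natCast_ne_top _)), one_mul]
    exact_mod_cast (by omega : p < p + r)
  refine ⟨?_, h1⟩
  rw [slopeMap, if_pos h1, ENNReal.inv_div (.inl (ENNReal.natCast_ne_top _))
    (.inl (by exact_mod_cast (by omega : p + r ≠ 0)))]
  push_cast
  rw [ENNReal.add_div, ENNReal.div_self hp0 hpt, ENNReal.add_sub_cancel_left ENNReal.one_ne_top]

/-- The subtractive Euclidean algorithm on coprime pairs, as an induction principle. -/
theorem coprime_pair_induction {C : ℕ → ℕ → Prop} (h1 : C 1 1)
    (h2 : ∀ r q, 0 < r → 0 < q → q.Coprime r → C q r → C (r + q) q)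
    (h3 : ∀ p r, 0 < p → 0 < r → r.Coprime p → C r p → C p (p + r)) :
    ∀ p q, 0 < p → 0 < q → p.Coprime q → C p q := by
  intro p q
  induction hn : p + q using Nat.strong_induction_on generalizing p q with
  | _ n ih =>
    intro hp hq hc
    rcases lt_trichotomy p q with h | h | h
    · obtain ⟨r, rfl⟩ := Nat.exists_eq_add_of_lt h
      rw [add_assoc] at hc ⊢
      have hc' : (r + 1).Coprime p := by
        rw [Nat.coprime_self_add_right] at hc
        exact hc.symm
      exact h3 p (r + 1) hp r.succ_pos hc' (ih (r + 1 + p) (by omega) _ _ rfl r.succ_pos hp hc')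
    · subst h
      rw [Nat.coprime_self] at hc
      subst hc
      exact h1
    · obtain ⟨r, rfl⟩ := Nat.exists_eq_add_of_lt h
      rw [show q + r + 1 = (r + 1) + q by ring] at hc ⊢
      have hc' : q.Coprime (r + 1) := by
        rw [Nat.coprime_add_self_left] at hc
        exact hc.symm
      exact h2 (r + 1) q r.succ_pos hq hc' (ih (q + (r + 1)) (by omega) _ _ rfl hq r.succ_pos hc')

theorem natCast_div_ne {p q : ℕ} (hp : 0 < p) (hq : 0 < q) :
    (p : ℝ≥0∞) / q ≠ 0 ∧ (p : ℝ≥0∞) / q ≠ ⊤ :=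
  ⟨(ENNReal.div_pos (by exact_mod_cast hp.ne') (ENNReal.natCast_ne_top q)).ne',
    ENNReal.div_ne_top (ENNReal.natCast_ne_top p) (by exact_mod_cast hq.ne')⟩

theorem terminates_div : ∀ p q : ℕ, 0 < p → 0 < q → p.Coprime q →
    Terminates ((p : ℝ≥0∞) / q) := by
  refine coprime_pair_induction ?_ ?_ ?_
  · refine ⟨1, one_pos, .inr ?_⟩
    simp [slopeMap_one]
  · intro r q hr hq _ h
    rw [← (slopeMap_add_div hr hq).1] at h
    exact h.of_slopeMap
  · intro p r hp hr _ h
    rw [← (slopeMap_div_add hp hr).1] at h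
    exact h.of_slopeMap

theorem indexShift_add_div {r q : ℕ} (hr : 0 < r) (hq : 0 < q) (hc : q.Coprime r) :
    indexShift (((r + q : ℕ) : ℝ≥0∞) / q) = indexShift ((q : ℝ≥0∞) / r) + 1 := by
  obtain ⟨e, h1⟩ := slopeMap_add_div hr hq
  have hn := natCast_div_ne hq hr
  rw [← e]
  rw [← e] at hn
  exact indexShift_of_one_le (e ▸ terminates_div q r hq hr hc) hn.1 hn.2 h1

theorem indexShift_div_add {p r : ℕ} (hp : 0 < p) (hr : 0 < r) (hc : r.Coprime p) :
    indexShift ((p : ℝ≥0∞) / (p + r : ℕ)) = indexShift ((r : ℝ≥0∞) / p) - 1 := by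
  obtain ⟨e, h1⟩ := slopeMap_div_add hp hr
  have hn := natCast_div_ne hr hp
  rw [← e]
  rw [← e] at hn
  exact indexShift_of_lt_one (e ▸ terminates_div r p hr hp hc) hn.1 hn.2 h1

/-! ### The orbit of a corner: Euclid run backwards. -/

/-- The point of the plane of `C(Xᵢ²)` with special coordinates `(qg, pg)`. -/
noncomputable def quadPt (i : ZMod 3) (g : ℝ) (p q : ℕ) : Pt :=
  fun j => if j = i then -((p + q) * g) else if j = i + 1 then -(p * g) else -(q * g)

theorem self_ne_add_one (i : ZMod 3) : i ≠ i + 1 := by revert i; decide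
theorem self_ne_sub_one (i : ZMod 3) : i ≠ i - 1 := by revert i; decide
theorem add_one_ne_sub_one (i : ZMod 3) : i + 1 ≠ i - 1 := by revert i; decide
theorem add_one_add_one (i : ZMod 3) : i + 1 + 1 = i - 1 := by revert i; decide
theorem sub_one_sub_one (i : ZMod 3) : i - 1 - 1 = i + 1 := by revert i; decide

theorem eq_quadPt_iff {i : ZMod 3} {g : ℝ} {p q : ℕ} {x : Pt} :
    x = quadPt i g p q ↔ x i = -((p + q) * g) ∧ x (i + 1) = -(p * g) ∧ x (i - 1) = -(q * g) := by
  have h1 := (self_ne_add_one i).symm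
  have h2 := (self_ne_sub_one i).symm
  have h3 := (add_one_ne_sub_one i).symm
  constructor
  · rintro rfl
    simp [quadPt, h1, h2, h3]
  · intro h
    funext k
    refine (forall_iff_of_distinct h1.symm h2.symm h3.symm
      (p := fun k => x k = quadPt i g p q k)).2 ?_ k
    simpa [quadPt, h1, h2, h3] using h

theorem quadPt_spec (i : ZMod 3) (g : ℝ) (p q : ℕ) :
    quadPt i g p q i = -((p + q) * g) ∧ quadPt i g p q (i + 1) = -(p * g) ∧
      quadPt i g p q (i - 1) = -(q * g) := eq_quadPt_iff.1 rfl

theorem tropVieta_add_one_quadPt {P : Params} {i : ZMod 3} {g : ℝ} {p q : ℕ}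
    (h : quadPt i g p q ∈ skeleton P) :
    vm P (i + 1) (quadPt i g p q) = 2 * -((p + q) * g) ∧
      tropVieta P (i + 1) (quadPt i g p q) = quadPt (i + 1) g q (q + p) := by
  obtain ⟨e0, e1, e2⟩ := quadPt_spec i g p q
  have hv := vm_eq_of_quad (self_ne_add_one i) (self_ne_sub_one i) (add_one_ne_sub_one i) h
    (by rw [e0, e1, e2]; ring)
  rw [e0] at hv
  refine ⟨hv, eq_quadPt_iff.2 ?_⟩
  rw [tropVieta_self, hv, add_one_add_one, add_sub_cancel_right,
    tropVieta_of_ne P (add_one_ne_sub_one i), tropVieta_of_ne P (self_ne_add_one i).symm, e0, e1, e2]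
  push_cast
  exact ⟨by ring, rfl, by ring⟩

theorem tropVieta_sub_one_quadPt {P : Params} {i : ZMod 3} {g : ℝ} {p q : ℕ}
    (h : quadPt i g p q ∈ skeleton P) :
    vm P (i - 1) (quadPt i g p q) = 2 * -((p + q) * g) ∧
      tropVieta P (i - 1) (quadPt i g p q) = quadPt (i - 1) g (q + p) p := by
  obtain ⟨e0, e1, e2⟩ := quadPt_spec i g p q
  have hv := vm_eq_of_quad (self_ne_sub_one i) (self_ne_add_one i) (add_one_ne_sub_one i).symm h
    (by rw [e0, e1, e2]; ring)
  rw [e0] at hv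
  refine ⟨hv, eq_quadPt_iff.2 ?_⟩
  rw [tropVieta_self, hv, sub_one_sub_one, sub_add_cancel,
    tropVieta_of_ne P (add_one_ne_sub_one i).symm, tropVieta_of_ne P (self_ne_sub_one i).symm,
    e0, e1, e2]
  push_cast
  exact ⟨by ring, by ring, rfl⟩

theorem tropVieta_corner {P : Params} {k : ZMod 3} {g : ℝ} (h : -threshold P k ≤ g) :
    vm P k (corner k g) = -(2 * g) ∧ tropVieta P k (corner k g) = quadPt k g 1 1 := by
  have hv := (corner_spec (self_ne_add_one k) (self_ne_sub_one k) (add_one_ne_sub_one k) h).2.2.2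
  refine ⟨hv, eq_quadPt_iff.2 ?_⟩
  rw [tropVieta_self, hv, tropVieta_of_ne P (self_ne_add_one k),
    tropVieta_of_ne P (self_ne_sub_one k), corner_self, corner_of_ne (self_ne_add_one k),
    corner_of_ne (self_ne_sub_one k)]
  push_cast
  exact ⟨by ring, by ring, by ring⟩

theorem Reach.mem_skeleton {P : Params} {q x : Pt} (h : Reach P q x) (hq : q ∈ skeleton P) :
    x ∈ skeleton P := by
  induction h with
  | base => exact hq
  | step j _ _ ih => exact tropVieta_mem_skeleton ih j

theorem corner_mem_skeleton {P : Params} {k : ZMod 3} {g : ℝ} (h : -threshold P k ≤ g) :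
    corner k g ∈ skeleton P :=
  (corner_spec (self_ne_add_one k) (self_ne_sub_one k) (add_one_ne_sub_one k) h).1

/-- Every quadratic point whose Euclidean algorithm ends at a corner of the skeleton is reached
from that corner. -/
theorem reach_quadPt {P : Params} {g : ℝ} (hg : 0 < g) :
    ∀ p q : ℕ, 0 < p → 0 < q → p.Coprime q → ∀ i k : ZMod 3,
      k = i + ((indexShift ((p : ℝ≥0∞) / q) : ℤ) : ZMod 3) - 1 → -threshold P k ≤ g →
      Reach P (corner k g) (quadPt i g p q) := by
  refine coprime_pair_induction ?_ ?_ ?_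
  · intro i k hk hP
    -- At slope `1` the shift is `1`, which cancels the `-1` in the index: the corner lies over the
    -- cell `i` itself.
    rw [Nat.cast_one, div_one, indexShift_one, Int.cast_one, add_sub_cancel_right] at hk
    subst hk
    obtain ⟨hv, ht⟩ := tropVieta_corner hP
    rw [← ht]
    refine Reach.base.step k ?_
    rw [hv, corner_self]
    linarith
  · intro r q hr hq hc ih i k hk hP
    rw [indexShift_add_div hr hq hc] at hk
    -- A slope above `1` descends to the cell `i + 1` with shift smaller by one, so `k` is
    -- unchanged.
    have h := ih (i + 1) k (by rw [hk]; push_cast; ring) hP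
    obtain ⟨hv, ht⟩ := tropVieta_sub_one_quadPt (h.mem_skeleton (corner_mem_skeleton hP))
    have := h.step (i + 1 - 1) (by
      rw [hv, (quadPt_spec _ _ _ _).2.2]
      have h1 : (0 : ℝ) < q := by exact_mod_cast hq
      have h2 : (0 : ℝ) < r := by exact_mod_cast hr
      nlinarith [mul_pos h1 hg, mul_pos h2 hg])
    rwa [ht, add_sub_cancel_right] at this
  · intro p r hp hr hc ih i k hk hP
    rw [indexShift_div_add hp hr hc] at hk
    have h := ih (i - 1) k (by rw [hk]; push_cast; ring) hP
    obtain ⟨hv, ht⟩ := tropVieta_add_one_quadPt (h.mem_skeleton (corner_mem_skeleton hP))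
    have := h.step (i - 1 + 1) (by
      rw [hv, (quadPt_spec _ _ _ _).2.1]
      have h1 : (0 : ℝ) < p := by exact_mod_cast hp
      have h2 : (0 : ℝ) < r := by exact_mod_cast hr
      nlinarith [mul_pos h1 hg, mul_pos h2 hg])
    rwa [ht, sub_add_cancel] at this

/-- Converse to `reach_quadPt`. The combination of cell index and shift is invariant along the
chain, and each step after the first is one of the two inverse Euclidean moves. -/
theorem Reach.eq_corner_or_quadPt {P : Params} {k : ZMod 3} {g : ℝ} (hP : -threshold P k ≤ g)
    {x : Pt} (h : Reach P (corner k g) x) :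
    x = corner k g ∨ ∃ (i : ZMod 3) (p q : ℕ), 0 < p ∧ 0 < q ∧ p.Coprime q ∧
      x = quadPt i g p q ∧ 2 * x i < vm P i x ∧
      k = i + ((indexShift ((p : ℝ≥0∞) / q) : ℤ) : ZMod 3) - 1 := by
  induction h with
  | base => exact .inl rfl
  | @step y j hy hj ih =>
    right
    have hsk := hy.mem_skeleton (corner_mem_skeleton hP)
    rcases ih with rfl | ⟨i, p, q, hp, hq, hc, rfl, hlt, hk⟩
    -- The other two involutions fix the corner, so only `s_k` can enter a domain.
    · have hjk : j = k := by
        by_contra hne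
        obtain ⟨l, hkl, hjl⟩ := exists_third (Ne.symm hne)
        have := (corner_spec (Ne.symm hne) hkl hjl hP).2.1
        rw [this, corner_of_ne (Ne.symm hne)] at hj
        linarith
      subst hjk
      refine ⟨j, 1, 1, one_pos, one_pos, Nat.coprime_one_left 1, (tropVieta_corner hP).2,
        tropVieta_lt_vm_iff.2 hj, ?_⟩
      rw [Nat.cast_one, div_one, indexShift_one, Int.cast_one, add_sub_cancel_right]
    · have hj3 := (exists_iff_of_distinct (self_ne_add_one i) (self_ne_sub_one i)
        (add_one_ne_sub_one i) (p := fun m => j = m)).1 ⟨j, rfl⟩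
      rcases hj3 with rfl | rfl | rfl
      · exact absurd hlt hj.not_gt
      · refine ⟨i + 1, q, q + p, hq, by omega, ?_, (tropVieta_add_one_quadPt hsk).2,
          tropVieta_lt_vm_iff.2 hj, ?_⟩
        · rw [Nat.coprime_self_add_right]; exact hc.symm
        · rw [indexShift_div_add hq hp hc, hk]; push_cast; ring
      · refine ⟨i - 1, q + p, p, by omega, hp, ?_, (tropVieta_sub_one_quadPt hsk).2,
          tropVieta_lt_vm_iff.2 hj, ?_⟩
        · rw [Nat.coprime_add_self_left]; exact hc.symm
        · rw [indexShift_add_div hq hp hc, hk]; push_cast; ring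

theorem coord_quadPt (i : ZMod 3) (g : ℝ) (p q : ℕ) :
    coordOne i (quadPt i g p q) = q * g ∧ coordTwo i (quadPt i g p q) = p * g := by
  obtain ⟨e0, e1, e2⟩ := quadPt_spec i g p q
  rw [coordOne, coordTwo, e0, e1, e2]
  constructor <;> ring

theorem slope_quadPt (i : ZMod 3) {g : ℝ} (hg : 0 < g) (p : ℕ) {q : ℕ} (hq : 0 < q) :
    slope i (quadPt i g p q) = (p : ℝ≥0∞) / q := by
  obtain ⟨e1, e2⟩ := coord_quadPt i g p q
  have hq' : (0 : ℝ) < q := by exact_mod_cast hq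
  rw [slope, e1, e2, ← ENNReal.ofReal_div_of_pos (mul_pos hq' hg), mul_div_mul_right _ _ hg.ne',
    ENNReal.ofReal_div_of_pos hq', ENNReal.ofReal_natCast, ENNReal.ofReal_natCast]

theorem neg_threshold_pos {P : Params} (h : P.d < 0 ∨ ∃ k, P.coef k < 0) (k : ZMod 3) :
    0 < -threshold P k := by
  by_contra! hcon
  obtain ⟨-, h1, h2, h3, h4⟩ := (neg_threshold_le_iff (self_ne_add_one k) (self_ne_sub_one k)
    (add_one_ne_sub_one k) P 0).1 hcon
  simp only [mul_zero, neg_zero, WithTop.coe_zero] at h1 h2 h3 h4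
  rcases h with h | ⟨m, h⟩
  · exact h4.not_gt h
  · exact ((forall_iff_of_distinct (self_ne_add_one k) (self_ne_sub_one k)
      (add_one_ne_sub_one k) (p := fun m => 0 ≤ P.coef m)).2 ⟨h1, h2, h3⟩ m).not_gt h

/-- Irrational slopes need no separate case: their gcd is `0`, below the positive number `-Θ_k`, and
their descent cannot end at a corner. -/
theorem notMem_orbitTable_iff {P : Params} (hmer : P.d < 0 ∨ ∃ k, P.coef k < 0)
    {i : ZMod 3} {x : Pt} (hx : x ∈ quadCellInterior P i) :
    x ∉ orbitTable P ↔ -threshold P (i + ((indexShift (slope i x) : ℤ) : ZMod 3) - 1) ≤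
      realGcd (coordOne i x) (coordTwo i x) := by
  have hij := self_ne_add_one i
  have hil := self_ne_sub_one i
  have hjl := add_one_ne_sub_one i
  obtain ⟨hsk, hs, hlt⟩ := of_mem_quadCellInterior hij hil hjl hx
  constructor
  · intro hU
    obtain ⟨q, hq, hqc, hr⟩ := exists_reach hmer hij hil hjl hsk hs hlt
    obtain ⟨k, g, hP, rfl⟩ := eq_corner hq hqc fun h => hU (hr.mem_orbitTable h)
    have hg := (neg_threshold_pos hmer k).trans_le hP
    rcases hr.eq_corner_or_quadPt hP with rfl | ⟨i', p, q, hp, hq, hc, rfl, hlt', hk⟩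
    · exact absurd hlt (hqc i).not_gt
    -- The cell found along the chain is the given one because the domains are disjoint.
    · have : i = i' := by
        by_contra hne
        exact (lt_of_lt_vm hne hlt).not_gt hlt'
      subst this
      rw [slope_quadPt i hg p hq, ← hk, (coord_quadPt i g p q).1, (coord_quadPt i g p q).2,
        realGcd_natMul hc hg]
      exact hP
  · intro h
    have hg := (neg_threshold_pos hmer _).trans_le h
    have h1 := vm_le hij P x
    have h2 := vm_le hil P x
    obtain ⟨p, q, hp, hq, hc, e1, e2⟩ := exists_natMul_of_realGcd_pos
      (by rw [coordOne]; linarith) (by rw [coordTwo]; linarith) hg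
    set g := realGcd (coordOne i x) (coordTwo i x)
    have hxq : x = quadPt i g p q := by
      rw [coordOne] at e1
      rw [coordTwo] at e2
      exact eq_quadPt_iff.2 ⟨by linarith, by linarith, by linarith⟩
    have hsl : slope i x = (p : ℝ≥0∞) / q := by
      rw [hxq]; exact slope_quadPt i hg p hq
    rw [hsl] at h
    have hr := reach_quadPt hg p q hp hq hc i _ rfl h
    rw [← hxq] at hr
    obtain ⟨c1, c2⟩ := corner_closed_table h
    exact hr.notMem_orbitTable c1 c2

end TropMarkov

theorem mainTheorem4 (a b c d : WithTop ℝ)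
    (hmer : min (min a b) (min c d) < 0)
    (i : ZMod 3) (x : TropMarkov.Pt)
    (hx : x ∈ TropMarkov.quadCellInterior ⟨a, b, c, d⟩ i) :
    TropMarkov.realGcd (TropMarkov.coordOne i x) (TropMarkov.coordTwo i x) =
        TropMarkov.realGcd (x 1 - x 3) (x 2 - x 3) ∧
      (x ∉ TropMarkov.orbitTable ⟨a, b, c, d⟩ ↔
        TropMarkov.realGcd (x 1 - x 3) (x 2 - x 3) ≥
          -TropMarkov.threshold ⟨a, b, c, d⟩
            (i + ((TropMarkov.indexShift (TropMarkov.slope i x) : ℤ) : ZMod 3) - 1)) := by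
  have hmer' : (⟨a, b, c, d⟩ : TropMarkov.Params).d < 0 ∨
      ∃ k, (⟨a, b, c, d⟩ : TropMarkov.Params).coef k < 0 := by
    simp only [min_lt_iff] at hmer
    rcases hmer with (h | h) | (h | h)
    · exact .inr ⟨1, h⟩
    · exact .inr ⟨2, h⟩
    · exact .inr ⟨3, h⟩
    · exact .inl h
  rw [← TropMarkov.realGcd_coord i x]
  exact ⟨rfl, TropMarkov.notMem_orbitTable_iff hmer' hx⟩
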